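/- **Proposition 2.1.** Let $m\in(0,1)$ (the Mach number) and $\theta\in(0,1)$. Let $U:[0,\infty)\to\mathbb R$ be a boundary layer profile: $U\in C^3([0,\infty))$, $U(0)=0$, $U(Y)>0$ for $Y>0$, $\lim_{Y\to\infty}U(Y)=1$, $U'(0)=1$; for some $s_0,s_1,s_2>0$, $s_1e^{-s_0Y}\le U'(Y)\le s_2e^{-s_0Y}$ for all $Y\ge 0$; and for some $\sigma_1,\sigma_2>0$ and all $Y>0$, $$\frac{-U''(1-m^2U^2)-2m^2U|U'|^2}{|U''|+|U'|^2}\ge\sigma_1,\qquad \left|\frac{U'''}{U''}\right|+\frac{|U''|}{U'}+\frac{1-U}{U'}\le\sigma_2 .$$ *Slow mode.* For $\alpha>0$ and $c\in\mathbb C$ with $\operatorname{Im}c>0$ and $|c|$ small put $A(Y)=1-m^2(U(Y)-c)^2$, $A_\infty=1-m^2(1-c)^2$, $\beta=\alpha A_\infty^{1/2}$ (principal branch), $\varphi_+(Y)=U(Y)-c$, $\varphi_-(Y)=(U(Y)-c)\int_1^Y\frac{dX}{(U(X)-c)^2}-m^2(U(Y)-c)Y$, $\varphi_{+,\alpha}=e^{-\beta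 Y}\varphi_+$, $$G(X,Y)=-(U(X)-c)^{-1}e^{-\beta(Y-X)}\begin{cases}\varphi_+(Y)\varphi_-(X),&X<Y,\\ \varphi_+(X)\varphi_-(Y),&X\geq Y,\end{cases}$$ $$\varphi_{1,\alpha}(Y)=2\int_0^\infty G(X,Y)A^{-2}(X)U'(X)\varphi_{+,\alpha}(X)\,dX,$$ and $\Phi=\varphi_{+,\alpha}+\beta\varphi_{1,\alpha}$. The slow mode is $v^s=-i\alpha\Phi$, $\rho^s=-m^2A^{-1}[(U-c)\partial_Y\Phi-\Phi U']$, $u^s=\partial_Y\Phi-(U-c)\rho^s$. *Fast mode.* Let $\mathrm{Ai}$ be the Airy function and $\mathrm{Ai}(1,\cdot),\mathrm{Ai}(2,\cdot)$ its first and second primitives vanishing at infinity along $e^{i\pi/6}\mathbb R_+$. For $\varepsilon>0$ let $n=\alpha/\sqrt\varepsilon$, $\delta=e^{-i\pi/6}n^{-1/3}$, $z_0=-\delta^{-1}c$, and $$u^f(Y)=-\frac{\mathrm{Ai}(1,\delta^{-1}Y+z_0)}{\mathrm{Ai}(2,z_0)},\qquad v^f(Y)=i\alpha\delta\,\frac{\mathrm{Ai}(2,\delta^{-1}Y+z_0)}{\mathrm{Ai}(2,z_0)}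 .$$ *Boundary function.* Let $u_{\rm app}=u^s-\frac{v^s(0)}{v^f(0)}u^f$ and $F_{\rm app}(c)=u_{\rm app}(0;c)$. *Disk.* For $K>0$ let $\alpha=K\varepsilon^{1/8}$, $$c_0=\left(\frac{K}{(1-m^2)^{1/2}}+K^{-1}(1-m^2)^{1/4}e^{i\pi/4}\right)\varepsilon^{1/8},\qquad D_0=\{c\in\mathbb C:\ |c-c_0|\le K^{-1-\theta}(1-m^2)^{1/4}\varepsilon^{1/8}\}.$$ Then there is $K_0>1$ such that for every $K\ge K_0$ there is $\varepsilon_1\in(0,1)$ such that for every $\varepsilon\in(0,\varepsilon_1)$, with $\alpha=K\varepsilon^{1/8}$: 1. for every $c\in D_0$: $\operatorname{Im}c>0$, $A(Y)\ne0$ for all $Y\ge0$, and $\mathrm{Ai}(2,z_0(c))\neq0$; moreover $F_{\rm app}$ is analytic on a neighbourhood of $D_0$; 2. $F_{\rm app}$ has exactly one zero in $D_0$; 3. $|F_{\rm app}(c)|\ge\frac12K^{-\theta}$ for every $c\in\partial D_0$. -/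

import Mathlib

open Set Filter Topology MeasureTheory

namespace CompressibleBL

noncomputable section

/-! ### The Airy function and its primitives -/

/-- The integrand `(-t)^(-k) exp(t³/3 - z t)` of the Laplace type contour integral for the Airy
function (`k = 0`), its primitives (`k > 0`) and its derivatives (`k < 0`). -/
def airyIntegrand (k : ℤ) (z t : ℂ) : ℂ :=
  (-t) ^ (-k) * Complex.exp (t ^ 3 / 3 - z * t)

/-- `airy 0` is the classical Airy function
`Ai(z) = (2πi)⁻¹ ∫ exp(t³/3 - z t) dt`, the contour running from `∞ e^{-iπ/3}` to `∞ e^{iπ/3}`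
and being deformed here into the vertical line `t = 1 + i s`, `s ∈ ℝ`, on which the integral
converges absolutely for every complex `z`.
For `k = 1, 2`, `airy k` is the `k`-th order primitive `Ai(k, ·)` of `Ai` that vanishes at infinity
along `e^{iπ/6} ℝ₊`; these properties are proved below in `airy_hasDerivAt`,
`airy_equation` and `airy_tendsto_zero`. -/
def airy (k : ℤ) (z : ℂ) : ℂ :=
  (2 * (Real.pi : ℂ))⁻¹ * ∫ s : ℝ, airyIntegrand k z (1 + s * Complex.I)

lemma airy_re_line (a s : ℝ) (z : ℂ) :
    ((((a : ℂ) + s * Complex.I) ^ 3 / 3 - z * (a + s * Complex.I))).re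
      = a ^ 3 / 3 - a * s ^ 2 - a * z.re + s * z.im := by
  have h : ((a : ℂ) + s * Complex.I) ^ 3 / 3
      = ((a ^ 3 / 3 - a * s ^ 2 : ℝ) : ℂ) + ((a ^ 2 * s - s ^ 3 / 3 : ℝ) : ℂ) * Complex.I := by
    have h2 := Complex.I_sq
    have h3 : Complex.I ^ 3 = -Complex.I := by rw [pow_succ, h2]; ring
    push_cast
    ring_nf
    rw [h2, h3]; ring
  rw [h, Complex.sub_re, Complex.add_re, Complex.re_ofReal_mul, Complex.ofReal_re]
  simp
  ring

lemma airyIntegrand_norm (k : ℤ) (z : ℂ) (a s : ℝ) :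
    ‖airyIntegrand k z (a + s * Complex.I)‖
      = ‖(a : ℂ) + s * Complex.I‖ ^ (-k)
        * Real.exp (a ^ 3 / 3 - a * s ^ 2 - a * z.re + s * z.im) := by
  rw [airyIntegrand, norm_mul, Complex.norm_exp, airy_re_line, norm_zpow, norm_neg]

lemma airy_le_norm_line (a s : ℝ) : a ≤ ‖(a : ℂ) + s * Complex.I‖ := by
  have := Complex.re_le_norm ((a : ℂ) + s * Complex.I)
  simpa using this

lemma airy_zpow_bound (k : ℤ) {a₀ a₁ : ℝ} (h₀ : 0 < a₀) :
    ∃ C : ℝ, 0 < C ∧ ∀ a ∈ Icc a₀ a₁, ∀ s : ℝ,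
      ‖(a : ℂ) + s * Complex.I‖ ^ (-k) ≤ C * Real.exp |s| := by
  obtain ⟨N, rfl | rfl⟩ := k.eq_nat_or_neg
  · refine ⟨(a₀ ^ N)⁻¹, by positivity, fun a ha s => ?_⟩
    have h1 : a₀ ≤ ‖(a : ℂ) + s * Complex.I‖ := ha.1.trans (airy_le_norm_line a s)
    rw [zpow_neg, zpow_natCast]
    have h2 : (‖(a : ℂ) + s * Complex.I‖ ^ N)⁻¹ ≤ (a₀ ^ N)⁻¹ := by gcongr
    have h3 : 1 ≤ Real.exp |s| := Real.one_le_exp (abs_nonneg s)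
    have h4 : 0 < (a₀ ^ N)⁻¹ := by positivity
    nlinarith
  · refine ⟨N.factorial * Real.exp |a₁|, by positivity, fun a ha s => ?_⟩
    rw [neg_neg, zpow_natCast]
    have h1 := Real.pow_div_factorial_le_exp ‖(a : ℂ) + s * Complex.I‖ (norm_nonneg _) N
    rw [div_le_iff₀ (by positivity)] at h1
    have h2 : ‖(a : ℂ) + s * Complex.I‖ ≤ |a₁| + |s| := by
      refine (norm_add_le _ _).trans ?_
      have ha0 : 0 ≤ a := h₀.le.trans ha.1
      have : |a| ≤ |a₁| := by
        rw [abs_of_nonneg ha0]; exact ha.2.trans (le_abs_self _)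
      simpa using this
    calc ‖(a : ℂ) + s * Complex.I‖ ^ N
        ≤ Real.exp ‖(a : ℂ) + s * Complex.I‖ * N.factorial := h1
      _ ≤ Real.exp (|a₁| + |s|) * N.factorial := by gcongr
      _ = N.factorial * Real.exp |a₁| * Real.exp |s| := by rw [Real.exp_add]; ring

lemma airyIntegrand_bound (k : ℤ) {a₀ a₁ : ℝ} (M : ℝ) (h₀ : 0 < a₀) :
    ∃ C : ℝ, ∀ a ∈ Icc a₀ a₁, ∀ z : ℂ, ‖z‖ ≤ M → ∀ s : ℝ,
      ‖airyIntegrand k z (a + s * Complex.I)‖ ≤ C * Real.exp (-(a₀ / 2) * s ^ 2) := by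
  obtain ⟨C, hC, hb⟩ := airy_zpow_bound k (a₁ := a₁) h₀
  refine ⟨C * Real.exp (a₁ ^ 3 / 3 + a₁ * M + (1 + M) ^ 2 / (2 * a₀)), fun a ha z hz s => ?_⟩
  rw [airyIntegrand_norm]
  have ha0 : 0 ≤ a := h₀.le.trans ha.1
  have hM : 0 ≤ M := (norm_nonneg z).trans hz
  have key : |s| + (a ^ 3 / 3 - a * s ^ 2 - a * z.re + s * z.im)
      ≤ (a₁ ^ 3 / 3 + a₁ * M + (1 + M) ^ 2 / (2 * a₀)) + (-(a₀ / 2) * s ^ 2) := by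
    have e1 : a ^ 3 ≤ a₁ ^ 3 := pow_le_pow_left₀ ha0 ha.2 3
    have e2 : -(a * z.re) ≤ a₁ * M := by
      have : -z.re ≤ M := (neg_le_abs _).trans ((Complex.abs_re_le_norm z).trans hz)
      nlinarith [ha.2]
    have e3 : s * z.im ≤ |s| * M := by
      calc s * z.im ≤ |s * z.im| := le_abs_self _
        _ = |s| * |z.im| := abs_mul _ _
        _ ≤ |s| * M := by gcongr; exact (Complex.abs_im_le_norm z).trans hz
    have e4 : a₀ * s ^ 2 ≤ a * s ^ 2 := by
      have := ha.1; gcongr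
    have e5 : |s| * (1 + M) ≤ (1 + M) ^ 2 / (2 * a₀) + a₀ / 2 * s ^ 2 := by
      have : (1 + M) ^ 2 / (2 * a₀) + a₀ / 2 * s ^ 2 - |s| * (1 + M)
          = (1 + M - a₀ * |s|) ^ 2 / (2 * a₀) := by
        field_simp
        rw [← sq_abs s]; ring
      have h6 : 0 ≤ (1 + M - a₀ * |s|) ^ 2 / (2 * a₀) := by positivity
      linarith
    linarith
  calc _ ≤ C * Real.exp |s| * Real.exp (a ^ 3 / 3 - a * s ^ 2 - a * z.re + s * z.im) := by
        gcongr; exact hb a ha s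
    _ = C * Real.exp (|s| + (a ^ 3 / 3 - a * s ^ 2 - a * z.re + s * z.im)) := by
        rw [Real.exp_add |s|]; ring
    _ ≤ C * Real.exp ((a₁ ^ 3 / 3 + a₁ * M + (1 + M) ^ 2 / (2 * a₀)) + (-(a₀ / 2) * s ^ 2)) := by
        gcongr
    _ = _ := by rw [Real.exp_add _ (-(a₀ / 2) * s ^ 2)]; ring

lemma airy_line_ne_zero {a : ℝ} (ha : 0 < a) (s : ℝ) : (a : ℂ) + s * Complex.I ≠ 0 := by
  intro h
  have := airy_le_norm_line a s
  rw [h, norm_zero] at this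
  linarith

lemma airyIntegrand_continuous (k : ℤ) (z : ℂ) {a : ℝ} (ha : 0 < a) :
    Continuous fun s : ℝ => airyIntegrand k z (a + s * Complex.I) := by
  unfold airyIntegrand
  refine Continuous.mul ?_ (by fun_prop)
  exact Continuous.zpow₀ (by fun_prop) _
    fun s => Or.inl (neg_ne_zero.2 (airy_line_ne_zero ha s))

lemma airyIntegrand_integrable (k : ℤ) (z : ℂ) {a : ℝ} (ha : 0 < a) :
    Integrable fun s : ℝ => airyIntegrand k z (a + s * Complex.I) := by
  obtain ⟨C, hC⟩ := airyIntegrand_bound k (a₁ := a) ‖z‖ ha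
  exact ((integrable_exp_neg_mul_sq (half_pos ha)).const_mul C).mono'
    (airyIntegrand_continuous k z ha).aestronglyMeasurable
    (ae_of_all _ fun s => hC a ⟨le_rfl, le_rfl⟩ z le_rfl s)

lemma airyIntegrand_hasDerivAt_z (k : ℤ) (z : ℂ) {t : ℂ} (ht : t ≠ 0) :
    HasDerivAt (fun z => airyIntegrand (k + 1) z t) (airyIntegrand k z t) z := by
  unfold airyIntegrand
  have h : HasDerivAt (fun z : ℂ => t ^ 3 / 3 - z * t) (-t) z := by
    simpa using ((hasDerivAt_id z).mul_const t).const_sub (t ^ 3 / 3)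
  refine ((h.cexp).const_mul ((-t) ^ (-(k + 1)))).congr_deriv ?_
  have : (-t) ^ (-k) = (-t) ^ (-(k + 1)) * (-t) := by
    rw [← zpow_add_one₀ (neg_ne_zero.2 ht)]; congr 1; ring
  rw [this]; ring

/-- `airy (k + 1)` is a primitive of `airy k`. -/
theorem airy_hasDerivAt (k : ℤ) (z : ℂ) : HasDerivAt (airy (k + 1)) (airy k z) z := by
  unfold airy
  refine HasDerivAt.const_mul _ ?_
  obtain ⟨C, hC⟩ := airyIntegrand_bound k (a₁ := 1) (‖z‖ + 1) one_pos
  have hm := fun (k : ℤ) (z : ℂ) => airyIntegrand_integrable k z one_pos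
  simp only [Complex.ofReal_one] at hC hm
  refine (hasDerivAt_integral_of_dominated_loc_of_deriv_le
    (F := fun z (s : ℝ) => airyIntegrand (k + 1) z (1 + s * Complex.I))
    (bound := fun s => C * Real.exp (-(1 / 2) * s ^ 2)) (Metric.ball_mem_nhds z one_pos)
    (Eventually.of_forall fun x => (hm (k + 1) x).aestronglyMeasurable)
    (hm _ z) (hm k z).aestronglyMeasurable
    (ae_of_all _ fun s x hx => hC 1 ⟨le_rfl, le_rfl⟩ x ?_ s)
    ((integrable_exp_neg_mul_sq (by norm_num)).const_mul C)
    (ae_of_all _ fun s x _ => airyIntegrand_hasDerivAt_z k x ?_)).2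
  · have h1 : ‖x - z‖ < 1 := by simpa [dist_eq_norm] using hx
    have h2 := norm_sub_norm_le x z
    linarith
  · simpa using airy_line_ne_zero one_pos s

lemma airyIntegrand_hasDerivAt_t (k : ℤ) (z : ℂ) {t : ℂ} (ht : t ≠ 0) :
    HasDerivAt (airyIntegrand k z) (k * airyIntegrand (k + 1) z t
      + airyIntegrand (k - 2) z t - z * airyIntegrand k z t) t := by
  unfold airyIntegrand
  have h : HasDerivAt (fun t : ℂ => t ^ 3 / 3 - z * t) (t ^ 2 - z) t := by
    have h1 := ((hasDerivAt_pow 3 t).div_const 3).sub ((hasDerivAt_id t).const_mul z)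
    refine h1.congr_deriv ?_
    simp
  have h0 : HasDerivAt (fun t : ℂ => (-t) ^ (-k)) (k * (-t) ^ (-(k + 1))) t := by
    have h1 := (hasDerivAt_zpow (-k) (-t) (Or.inl (neg_ne_zero.2 ht))).comp t (hasDerivAt_neg t)
    refine h1.congr_deriv ?_
    have : -(k + 1) = -k - 1 := by ring
    rw [this]; push_cast; ring
  refine (h0.mul h.cexp).congr_deriv ?_
  have e2 : (-t) ^ (-(k - 2)) = (-t) ^ (-k) * t ^ 2 := by
    have : -(k - 2) = -k + 2 := by ring
    rw [this, zpow_add₀ (neg_ne_zero.2 ht)]; norm_cast; ring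
  rw [e2]; ring

lemma airyIntegrand_integral_deriv (k : ℤ) (z : ℂ) {a : ℝ} (ha : 0 < a) :
    ∫ s : ℝ, ((k : ℂ) * airyIntegrand (k + 1) z (a + s * Complex.I)
      + airyIntegrand (k - 2) z (a + s * Complex.I)
      - z * airyIntegrand k z (a + s * Complex.I)) = 0 := by
  have hi := fun k => airyIntegrand_integrable k z ha
  have hd : ∀ s : ℝ, HasDerivAt (fun s : ℝ => airyIntegrand k z (a + s * Complex.I))
      (((k : ℂ) * airyIntegrand (k + 1) z (a + s * Complex.I)
      + airyIntegrand (k - 2) z (a + s * Complex.I)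
      - z * airyIntegrand k z (a + s * Complex.I)) * Complex.I) s := by
    intro s
    have h1 : HasDerivAt (fun s : ℝ => (a : ℂ) + s * Complex.I) Complex.I s := by
      simpa using ((hasDerivAt_id s).ofReal_comp.mul_const Complex.I).const_add (a : ℂ)
    exact (airyIntegrand_hasDerivAt_t k z (airy_line_ne_zero ha s)).comp s h1
  have hint := (((hi (k + 1)).const_mul (k : ℂ)).add (hi (k - 2))).sub ((hi k).const_mul z)
  have := integral_eq_zero_of_hasDerivAt_of_integrable hd (hint.mul_const Complex.I) (hi k)
  rw [integral_mul_const] at this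
  exact (mul_eq_zero.1 this).resolve_right Complex.I_ne_zero

/-- The Airy equation: the second derivative `airy (-2)` of `Ai` equals `z Ai`. -/
theorem airy_equation (z : ℂ) : airy (-2) z = z * airy 0 z := by
  have h := airyIntegrand_integral_deriv 0 z one_pos
  have hi := fun k => airyIntegrand_integrable k z one_pos
  simp only [Complex.ofReal_one, Int.cast_zero, zero_mul, zero_add, zero_sub] at h hi
  rw [integral_sub (hi _) ((hi _).const_mul z), integral_const_mul] at h
  unfold airy
  rw [sub_eq_zero.1 h]; ring

lemma airyIntegrand_integral_const (k : ℤ) (z : ℂ) {a : ℝ} (ha : 0 < a) :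
    ∫ s : ℝ, airyIntegrand k z (a + s * Complex.I)
      = ∫ s : ℝ, airyIntegrand k z (1 + s * Complex.I) := by
  set g : ℝ → ℂ := fun a => ∫ s : ℝ, airyIntegrand k z (a + s * Complex.I) with hg
  have hd : ∀ b ∈ Ioi (0 : ℝ), HasDerivAt g 0 b := by
    intro b hb
    have hb : 0 < b := hb
    obtain ⟨C₁, hC₁⟩ := airyIntegrand_bound (k + 1) (a₁ := 2 * b) ‖z‖ (half_pos hb)
    obtain ⟨C₂, hC₂⟩ := airyIntegrand_bound (k - 2) (a₁ := 2 * b) ‖z‖ (half_pos hb)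
    obtain ⟨C₃, hC₃⟩ := airyIntegrand_bound k (a₁ := 2 * b) ‖z‖ (half_pos hb)
    have hi := fun k => airyIntegrand_integrable k z hb
    have hint := (((hi (k + 1)).const_mul (k : ℂ)).add (hi (k - 2))).sub ((hi k).const_mul z)
    have hnhds : Icc (b / 2) (2 * b) ∈ 𝓝 b := Icc_mem_nhds (by linarith) (by linarith)
    have := (hasDerivAt_integral_of_dominated_loc_of_deriv_le
      (F := fun a (s : ℝ) => airyIntegrand k z ((a : ℝ) + s * Complex.I))
      (F' := fun a (s : ℝ) => (k : ℂ) * airyIntegrand (k + 1) z ((a : ℝ) + s * Complex.I)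
        + airyIntegrand (k - 2) z ((a : ℝ) + s * Complex.I)
        - z * airyIntegrand k z ((a : ℝ) + s * Complex.I))
      (bound := fun s => (‖(k : ℂ)‖ * C₁ + C₂ + ‖z‖ * C₃)
        * Real.exp (-(b / 2 / 2) * s ^ 2)) hnhds
      (by
        filter_upwards [Ioi_mem_nhds hb] with x hx
        exact (airyIntegrand_integrable k z hx).aestronglyMeasurable)
      (hi k) hint.aestronglyMeasurable
      (ae_of_all _ fun s x hx => ?_)
      ((integrable_exp_neg_mul_sq (by positivity)).const_mul _)
      (ae_of_all _ fun s x hx => ?_)).2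
    · rwa [airyIntegrand_integral_deriv k z hb] at this
    · refine (norm_sub_le _ _).trans ?_
      refine (add_le_add (norm_add_le _ _) le_rfl).trans ?_
      rw [norm_mul, norm_mul]
      have e1 := mul_le_mul_of_nonneg_left (hC₁ x hx z le_rfl s) (norm_nonneg (k : ℂ))
      have e2 := hC₂ x hx z le_rfl s
      have e3 := mul_le_mul_of_nonneg_left (hC₃ x hx z le_rfl s) (norm_nonneg z)
      linarith
    · have hx0 : 0 < x := (half_pos hb).trans_le hx.1
      have h1 : HasDerivAt (fun x : ℝ => (x : ℂ) + s * Complex.I) 1 x := by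
        simpa using (hasDerivAt_id x).ofReal_comp.add_const ((s : ℂ) * Complex.I)
      exact ((airyIntegrand_hasDerivAt_t k z (airy_line_ne_zero hx0 s)).comp x h1).congr_deriv
        (mul_one _)
  have := isOpen_Ioi.is_const_of_deriv_eq_zero isPreconnected_Ioi
    (fun b hb => (hd b hb).differentiableAt.differentiableWithinAt)
    (fun b hb => (hd b hb).deriv) (show a ∈ Ioi (0 : ℝ) from ha)
    (show (1 : ℝ) ∈ Ioi (0 : ℝ) from mem_Ioi.2 one_pos)
  simpa [hg] using this

lemma airy_norm_le (k : ℕ) (z : ℂ) {a : ℝ} (ha : 1 ≤ a) :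
    ‖airy k z‖ ≤ ‖(2 * (Real.pi : ℂ))⁻¹‖ * (∫ s : ℝ, Real.exp (-(1 / 2) * s ^ 2))
      * Real.exp (a ^ 3 / 3 - a * z.re + z.im ^ 2 / (2 * a)) := by
  have ha0 : 0 < a := one_pos.trans_le ha
  unfold airy
  rw [← airyIntegrand_integral_const k z ha0, norm_mul, mul_assoc]
  gcongr
  rw [← integral_mul_const]
  refine norm_integral_le_of_norm_le
    ((integrable_exp_neg_mul_sq (by norm_num)).mul_const _) (ae_of_all _ fun s => ?_)
  rw [airyIntegrand_norm, ← Real.exp_add, zpow_neg, zpow_natCast]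
  have h1 : (‖(a : ℂ) + s * Complex.I‖ ^ k)⁻¹ ≤ 1 :=
    inv_le_one_of_one_le₀ (one_le_pow₀ (ha.trans (airy_le_norm_line a s)))
  have h2 : a ^ 3 / 3 - a * s ^ 2 - a * z.re + s * z.im
      ≤ -(1 / 2) * s ^ 2 + (a ^ 3 / 3 - a * z.re + z.im ^ 2 / (2 * a)) := by
    have e1 : z.im ^ 2 / (2 * a) + a / 2 * s ^ 2 - s * z.im = (z.im - a * s) ^ 2 / (2 * a) := by
      field_simp; ring
    have e2 : 0 ≤ (z.im - a * s) ^ 2 / (2 * a) := by positivity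
    nlinarith [sq_nonneg s]
  calc _ ≤ 1 * Real.exp (a ^ 3 / 3 - a * s ^ 2 - a * z.re + s * z.im) := by gcongr
    _ ≤ _ := by rw [one_mul]; gcongr

/-- `Ai(k, ·)`, `k = 0, 1, 2, …`, vanishes at infinity along `e^{iπ/6} ℝ₊`. -/
theorem airy_tendsto_zero (k : ℕ) (w : ℂ) :
    Tendsto (fun r : ℝ => airy k (w + Complex.exp (Complex.I * Real.pi / 6) * r)) atTop (𝓝 0) := by
  have hexp : Complex.exp (Complex.I * Real.pi / 6)
      = ((√3 / 2 : ℝ) : ℂ) + ((1 / 2 : ℝ) : ℂ) * Complex.I := by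
    have : Complex.I * Real.pi / 6 = ((Real.pi / 6 : ℝ) : ℂ) * Complex.I := by push_cast; ring
    rw [this, Complex.exp_mul_I, ← Complex.ofReal_cos, ← Complex.ofReal_sin,
      Real.cos_pi_div_six, Real.sin_pi_div_six]
  set A : ℝ := ‖(2 * (Real.pi : ℂ))⁻¹‖ * (∫ s : ℝ, Real.exp (-(1 / 2) * s ^ 2)) with hA
  have hA0 : 0 ≤ A := by
    rw [hA]; exact mul_nonneg (norm_nonneg _) (integral_nonneg fun s => (Real.exp_pos _).le)
  have hB : ∀ᶠ r : ℝ in atTop, ‖airy k (w + Complex.exp (Complex.I * Real.pi / 6) * r)‖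
      ≤ A * Real.exp (-√r) := by
    have hlarge : ∀ᶠ r : ℝ in atTop, max 1 (4 * (2 * ‖w‖ + ‖w‖ ^ 2 + 1)) ≤ √r :=
      Real.tendsto_sqrt_atTop.eventually_ge_atTop _
    filter_upwards [hlarge, eventually_ge_atTop 0] with r hr hr0
    have h1 : 1 ≤ √r := (le_max_left _ _).trans hr
    have h2 : 4 * (2 * ‖w‖ + ‖w‖ ^ 2 + 1) ≤ √r := (le_max_right _ _).trans hr
    refine (airy_norm_le k _ h1).trans ?_
    have hsq : r = √r ^ 2 := (Real.sq_sqrt hr0).symm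
    set a := √r with ha
    have hre : (w + Complex.exp (Complex.I * Real.pi / 6) * r).re = w.re + √3 / 2 * r := by
      rw [hexp]; simp
    have him : (w + Complex.exp (Complex.I * Real.pi / 6) * r).im = w.im + r / 2 := by
      rw [hexp]; simp; ring
    rw [hre, him]
    gcongr
    rw [hsq]
    have ha0 : 0 < a := by linarith
    have e0 : (w.im + a ^ 2 / 2) ^ 2 / (2 * a) = w.im ^ 2 / (2 * a) + a * w.im / 2 + a ^ 3 / 8 := by
      field_simp; ring
    rw [e0]
    have hw := norm_nonneg w
    have e1 : -w.re ≤ ‖w‖ := (neg_le_abs _).trans (Complex.abs_re_le_norm w)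
    have e2 : w.im ≤ ‖w‖ := (le_abs_self _).trans (Complex.abs_im_le_norm w)
    have e3 : w.im ^ 2 / (2 * a) ≤ ‖w‖ ^ 2 := by
      rw [div_le_iff₀ (by positivity)]
      have : w.im ^ 2 ≤ ‖w‖ ^ 2 := by
        rw [← sq_abs w.im]; gcongr; exact Complex.abs_im_le_norm w
      nlinarith [sq_nonneg ‖w‖]
    have e4 : (1.7 : ℝ) ≤ √3 := by
      apply Real.le_sqrt_of_sq_le; norm_num
    have e5 : 1.7 * a ^ 3 ≤ √3 * a ^ 3 := by gcongr
    have e6 : 4 * (2 * ‖w‖ + ‖w‖ ^ 2 + 1) * a ≤ a * a := by gcongr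
    have e7 : a * a ≤ a ^ 3 := by nlinarith [sq_nonneg a]
    have e8 : -(a * w.re) ≤ ‖w‖ * a := by nlinarith
    have e9 : a * w.im ≤ ‖w‖ * a := by nlinarith
    have e10 : ‖w‖ ^ 2 ≤ ‖w‖ ^ 2 * a := by nlinarith [sq_nonneg ‖w‖]
    nlinarith
  have hlim : Tendsto (fun r : ℝ => A * Real.exp (-√r)) atTop (𝓝 0) := by
    have := (Real.tendsto_exp_neg_atTop_nhds_zero.comp Real.tendsto_sqrt_atTop).const_mul A
    simpa [Function.comp_def] using this
  exact squeeze_zero_norm' hB hlim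

/-! ### The shear profile -/

/-- The `k`-th derivative on the closed half line `Y ≥ 0` (one-sided at `Y = 0`). -/
def profileDeriv (k : ℕ) (U : ℝ → ℝ) (Y : ℝ) : ℝ :=
  iteratedDerivWithin k U (Ici 0) Y

/-- The class of uniformly subsonic boundary layer profiles `U` at Mach number `m`. Only the values
of `U` on `Y ≥ 0` are constrained and used. -/
structure IsBoundaryLayerProfile (m : ℝ) (U : ℝ → ℝ) : Prop where
  contDiffOn : ContDiffOn ℝ 3 U (Ici 0)
  zero : U 0 = 0
  pos : ∀ Y > 0, 0 < U Y
  tendsto_one : Tendsto U atTop (𝓝 1)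
  deriv_zero : profileDeriv 1 U 0 = 1
  exp_decay : ∃ s₀ > 0, ∃ s₁ > 0, ∃ s₂ > 0, ∀ Y ≥ 0,
    s₁ * Real.exp (-s₀ * Y) ≤ profileDeriv 1 U Y ∧ profileDeriv 1 U Y ≤ s₂ * Real.exp (-s₀ * Y)
  subsonic : ∃ σ₁ > 0, ∀ Y > 0,
    σ₁ ≤ (-profileDeriv 2 U Y * (1 - m ^ 2 * U Y ^ 2) - 2 * m ^ 2 * U Y * |profileDeriv 1 U Y| ^ 2)
      / (|profileDeriv 2 U Y| + |profileDeriv 1 U Y| ^ 2)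
  ratio_bound : ∃ σ₂ > 0, ∀ Y > 0,
    |profileDeriv 3 U Y / profileDeriv 2 U Y| + |profileDeriv 2 U Y| / profileDeriv 1 U Y
      + (1 - U Y) / profileDeriv 1 U Y ≤ σ₂

/-! ### The slow mode (approximate solution of the Lee-Lin equation)

Parameters: Mach number `m`, wave number `α`, profile `U`, wave speed `c`. -/

/-- `A(Y) = 1 - m² (U(Y) - c)²`. -/
def coeffA (m : ℝ) (U : ℝ → ℝ) (c : ℂ) (Y : ℝ) : ℂ :=
  1 - (m : ℂ) ^ 2 * ((U Y : ℂ) - c) ^ 2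

/-- The limit of `A(Y)` as `Y → +∞`. -/
def coeffAInfty (m : ℝ) (c : ℂ) : ℂ :=
  1 - (m : ℂ) ^ 2 * (1 - c) ^ 2

/-- `β = α A_∞^{1/2}`, with the principal square root. -/
def decayRate (m α : ℝ) (c : ℂ) : ℂ :=
  (α : ℂ) * coeffAInfty m c ^ (1 / 2 : ℂ)

/-- `φ₊`, the first solution of the Lee-Lin equation with `α = 0`. -/
def phiPlus (U : ℝ → ℝ) (c : ℂ) (Y : ℝ) : ℂ :=
  (U Y : ℂ) - c

/-- `φ₋`, the second solution of the Lee-Lin equation with `α = 0`. -/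
def phiMinus (m : ℝ) (U : ℝ → ℝ) (c : ℂ) (Y : ℝ) : ℂ :=
  ((U Y : ℂ) - c) * (∫ X in (1 : ℝ)..Y, 1 / ((U X : ℂ) - c) ^ 2)
    - (m : ℂ) ^ 2 * ((U Y : ℂ) - c) * (Y : ℂ)

/-- `φ_{+,α}(Y) = e^{-βY} φ₊(Y)`. -/
def phiPlusAlpha (m α : ℝ) (U : ℝ → ℝ) (c : ℂ) (Y : ℝ) : ℂ :=
  Complex.exp (-decayRate m α c * (Y : ℂ)) * phiPlus U c Y

/-- The approximate Green's function `G_α(X, Y)`. -/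
def greenFn (m α : ℝ) (U : ℝ → ℝ) (c : ℂ) (X Y : ℝ) : ℂ :=
  -((U X : ℂ) - c)⁻¹ * (Complex.exp (-decayRate m α c * ((Y : ℂ) - (X : ℂ))) *
    (if X < Y then phiPlus U c Y * phiMinus m U c X else phiPlus U c X * phiMinus m U c Y))

/-- The corrector `φ_{1,α}`. -/
def corrector (m α : ℝ) (U : ℝ → ℝ) (c : ℂ) (Y : ℝ) : ℂ :=
  2 * ∫ X in Ioi (0 : ℝ), greenFn m α U c X Y * (coeffA m U c X ^ 2)⁻¹
    * (profileDeriv 1 U X : ℂ) * phiPlusAlpha m α U c X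

/-- The approximate solution `Φ = φ_{+,α} + β φ_{1,α}` of the Lee-Lin equation. -/
def slowPhi (m α : ℝ) (U : ℝ → ℝ) (c : ℂ) (Y : ℝ) : ℂ :=
  phiPlusAlpha m α U c Y + decayRate m α c * corrector m α U c Y

/-- `∂_Y Φ` on `Y ≥ 0` (one-sided at `Y = 0`). -/
def slowPhiDeriv (m α : ℝ) (U : ℝ → ℝ) (c : ℂ) (Y : ℝ) : ℂ :=
  derivWithin (slowPhi m α U c) (Ici 0) Y

/-- Density of the slow mode. -/
def slowRho (m α : ℝ) (U : ℝ → ℝ) (c : ℂ) (Y : ℝ) : ℂ :=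
  -(m : ℂ) ^ 2 * (coeffA m U c Y)⁻¹ * (((U Y : ℂ) - c) * slowPhiDeriv m α U c Y
    - slowPhi m α U c Y * (profileDeriv 1 U Y : ℂ))

/-- Tangential velocity of the slow mode. -/
def slowU (m α : ℝ) (U : ℝ → ℝ) (c : ℂ) (Y : ℝ) : ℂ :=
  slowPhiDeriv m α U c Y - ((U Y : ℂ) - c) * slowRho m α U c Y

/-- Normal velocity of the slow mode. -/
def slowV (m α : ℝ) (U : ℝ → ℝ) (c : ℂ) (Y : ℝ) : ℂ :=
  -Complex.I * (α : ℂ) * slowPhi m α U c Y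

/-! ### The fast mode (viscous sublayer)

`ε` is the viscosity parameter, and `n = α / √ε` the rescaled frequency. -/

/-- The complex sublayer scale `δ = e^{-iπ/6} n^{-1/3}`. -/
def sublayerScale (α ε : ℝ) : ℂ :=
  Complex.exp (-(Real.pi * Complex.I) / 6) * (((α / √ε) ^ (-(1 / 3) : ℝ) : ℝ) : ℂ)

/-- `z₀ = -δ⁻¹ c`. -/
def airyPoint (α ε : ℝ) (c : ℂ) : ℂ :=
  -(sublayerScale α ε)⁻¹ * c

/-- Tangential velocity of the fast mode, `-Ai(1, z + z₀) / Ai(2, z₀)` at `z = δ⁻¹ Y`. -/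
def fastU (α ε : ℝ) (c : ℂ) (Y : ℝ) : ℂ :=
  -airy 1 ((sublayerScale α ε)⁻¹ * (Y : ℂ) + airyPoint α ε c) / airy 2 (airyPoint α ε c)

/-- Normal velocity of the fast mode, `iαδ Ai(2, z + z₀) / Ai(2, z₀)` at `z = δ⁻¹ Y`. -/
def fastV (α ε : ℝ) (c : ℂ) (Y : ℝ) : ℂ :=
  Complex.I * (α : ℂ) * sublayerScale α ε *
    (airy 2 ((sublayerScale α ε)⁻¹ * (Y : ℂ) + airyPoint α ε c) / airy 2 (airyPoint α ε c))

/-! ### The approximate growing mode -/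

/-- Tangential velocity of the approximate growing mode: the slow mode minus the multiple of the
fast mode that cancels the normal velocity at `Y = 0`. -/
def appU (m α ε : ℝ) (U : ℝ → ℝ) (c : ℂ) (Y : ℝ) : ℂ :=
  slowU m α U c Y - slowV m α U c 0 / fastV α ε c 0 * fastU α ε c Y

/-- The boundary function `F_app(c) = u_app(0; c)`. -/
def boundaryFn (m α ε : ℝ) (U : ℝ → ℝ) (c : ℂ) : ℂ :=
  appU m α ε U c 0

/-- The wave number `α = K ε^{1/8}`. -/
def waveNumber (K ε : ℝ) : ℝ :=
  K * ε ^ (1 / 8 : ℝ)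

/-- The centre
`c₀ = (K (1 - m²)^{-1/2} + K⁻¹ (1 - m²)^{1/4} e^{iπ/4}) ε^{1/8}`. -/
def diskCenter (m K ε : ℝ) : ℂ :=
  (((K / (1 - m ^ 2) ^ (1 / 2 : ℝ) : ℝ) : ℂ)
    + ((K⁻¹ * (1 - m ^ 2) ^ (1 / 4 : ℝ) : ℝ) : ℂ) * Complex.exp (Real.pi * Complex.I / 4))
    * ((ε ^ (1 / 8 : ℝ) : ℝ) : ℂ)

/-- The radius `K^{-1-θ} (1 - m²)^{1/4} ε^{1/8}`. -/
def diskRadius (m θ K ε : ℝ) : ℝ :=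
  K ^ (-1 - θ) * (1 - m ^ 2) ^ (1 / 4 : ℝ) * ε ^ (1 / 8 : ℝ)

/-- The closed disk `D₀`. -/
def disk (m θ K ε : ℝ) : Set ℂ :=
  Metric.closedBall (diskCenter m K ε) (diskRadius m θ K ε)

/-- The circle `∂D₀`. -/
def diskBoundary (m θ K ε : ℝ) : Set ℂ :=
  Metric.sphere (diskCenter m K ε) (diskRadius m θ K ε)

end

end CompressibleBL

open CompressibleBL

namespace CompressibleBL

noncomputable section

/-! Write `η = ε^{1/8}`, `c = η ζ`, `ν = (1 - m²)^{1/4}`. Since `α = K η`, the sublayer scale `δ` is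
also proportional to `η`, and the Airy argument `z₀ = -e^{iπ/6} K^{1/3} ζ` does not involve `ε`.
Only the boundary data of the slow mode do, and these are explicit: in the corrector the
exponentials merge into `e^{-βY}`, and `(U - c) A⁻² U'` has an elementary primitive, so `Φ(0)` and
`Φ'(0)` are expressed through `β` and `S = ∫₀¹ (U - c)⁻²` (`corrector_eq`, `boundaryFn_eq`).

Because `U'(0) = 1`, `S = -1/c` up to a logarithm (`exists_criticalIntegral_bound`). Hence `Φ(0)/η →
K/ν² - ζ` and `Φ'(0) → 1`, and `F_app` converges, uniformly in `ζ` on the sets considered, to `1 -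
e^{iπ/6} K^{1/3} (K/ν² - ζ) Ai(1, z₀) / Ai(2, z₀)` (`boundaryFn_limit`).

For large `K` and `ζ` near `K/ν²`, `z₀ = t²` with `t ≈ e^{-5πi/12} K^{2/3}/ν` in the right half
plane. Steepest descent through the saddle `t` gives the Airy quotient `-t (1 + O(|t|^{-3/2}))`
(`airy_quotient_asymptotics`). So the limit is within `O(1/K)` of the affine function `1 + e^{-iπ/4}
(K/ν)(K/ν² - ζ)` (`limit_dispersion`), whose zero is the rescaled disk centre. On the rescaled
boundary circle that affine function has modulus `K^{-θ}`, which dominates `1/K` because `θ < 1`.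
Choosing `K` first and `ε` afterwards, a contraction argument
(`existsUnique_zero_of_norm_sub_affine_le`) transfers the simple zero and the lower bound to
`F_app`. -/

/-! ### Asymptotics of the Airy primitives in a sector -/

/-- The normalized Airy integral along the vertical line through the saddle point `t`. -/
def saddleIntegral (k : ℤ) (t : ℂ) : ℂ :=
  ∫ s : ℝ, (1 + (s : ℂ) * Complex.I / t) ^ (-k) *
    Complex.exp (-t * (s : ℂ) ^ 2 - Complex.I * (s : ℂ) ^ 3 / 3)

/-- The point `t` is critical for the phase `w³/3 - t² w`, so the expansion around it has no linear
term in `s`. -/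
lemma airyIntegrand_saddle (k : ℤ) {t : ℂ} (ht : t ≠ 0) (s : ℝ) :
    airyIntegrand k (t ^ 2) (t + s * Complex.I)
      = Complex.exp (-(2 / 3) * t ^ 3) * (-t) ^ (-k) *
        ((1 + (s : ℂ) * Complex.I / t) ^ (-k) *
          Complex.exp (-t * (s : ℂ) ^ 2 - Complex.I * (s : ℂ) ^ 3 / 3)) := by
  unfold airyIntegrand
  have h1 : -(t + s * Complex.I) = -t * (1 + (s : ℂ) * Complex.I / t) := by
    field_simp
  have h2 : (t + s * Complex.I) ^ 3 / 3 - t ^ 2 * (t + s * Complex.I)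
      = -(2 / 3) * t ^ 3 + (-t * (s : ℂ) ^ 2 - Complex.I * (s : ℂ) ^ 3 / 3) := by
    have e2 := Complex.I_sq
    have e3 : Complex.I ^ 3 = -Complex.I := by rw [pow_succ, e2]; ring
    ring_nf
    rw [e2, e3]; ring
  rw [h1, h2, mul_zpow, Complex.exp_add]
  ring

/-- The contour may be moved to the vertical line through `t` because `Re t > 0`; a shift of the
parameter by `Im t` then puts the saddle at `s = 0`. -/
lemma airy_sq_eq (k : ℤ) {t : ℂ} (ht : 0 < t.re) :
    airy k (t ^ 2) = (2 * (Real.pi : ℂ))⁻¹ * (Complex.exp (-(2 / 3) * t ^ 3) * (-t) ^ (-k))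
      * saddleIntegral k t := by
  have ht0 : t ≠ 0 := by rintro rfl; simp at ht
  have h : ∀ s : ℝ, ((t.re : ℂ) + ((s + t.im : ℝ) : ℂ) * Complex.I) = t + s * Complex.I := by
    intro s
    conv_rhs => rw [← Complex.re_add_im t]
    push_cast; ring
  unfold airy saddleIntegral
  rw [← airyIntegrand_integral_const k (t ^ 2) ht,
    ← integral_add_right_eq_self (fun s : ℝ => airyIntegrand k (t ^ 2) (t.re + s * Complex.I)) t.im,
    mul_assoc]
  congr 1
  refine (integral_congr_ae (ae_of_all _ fun s => ?_)).trans (integral_const_mul _ _)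
  rw [h s, airyIntegrand_saddle k ht0 s]

lemma saddle_integrable (k : ℤ) {t : ℂ} (ht : 0 < t.re) :
    Integrable fun s : ℝ => (1 + (s : ℂ) * Complex.I / t) ^ (-k) *
      Complex.exp (-t * (s : ℂ) ^ 2 - Complex.I * (s : ℂ) ^ 3 / 3) := by
  have ht0 : t ≠ 0 := by rintro rfl; simp at ht
  have h : ∀ s : ℝ, ((t.re : ℂ) + ((s + t.im : ℝ) : ℂ) * Complex.I) = t + s * Complex.I := by
    intro s
    conv_rhs => rw [← Complex.re_add_im t]
    push_cast; ring
  have h1 := (airyIntegrand_integrable k (t ^ 2) ht).comp_add_right t.im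
  have h2 := h1.const_mul (Complex.exp (-(2 / 3) * t ^ 3) * (-t) ^ (-k))⁻¹
  refine h2.congr (ae_of_all _ fun s => ?_)
  simp only
  rw [h s, airyIntegrand_saddle k ht0 s]
  have : Complex.exp (-(2 / 3) * t ^ 3) * (-t) ^ (-k) ≠ 0 :=
    mul_ne_zero (Complex.exp_ne_zero _) (zpow_ne_zero _ (neg_ne_zero.2 ht0))
  rw [inv_mul_cancel_left₀ this]

lemma integrable_abs_pow_mul_exp_neg_mul_sq (j : ℕ) {b : ℝ} (hb : 0 < b) :
    Integrable fun s : ℝ => |s| ^ j * Real.exp (-b * s ^ 2) := by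
  have h := (integrable_rpow_mul_exp_neg_mul_sq hb (s := (j : ℝ))
    (lt_of_lt_of_le (by norm_num) (Nat.cast_nonneg j))).norm
  refine h.congr (ae_of_all _ fun s => ?_)
  simp

lemma integral_abs_pow_mul_exp_neg_mul_sq (j : ℕ) {b : ℝ} (hb : 0 < b) :
    ∫ s : ℝ, |s| ^ j * Real.exp (-b * s ^ 2)
      = b ^ (-((j : ℝ) + 1) / 2) * Real.Gamma (((j : ℝ) + 1) / 2) := by
  have h1 := integral_comp_abs (f := fun x : ℝ => x ^ j * Real.exp (-b * x ^ 2))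
  simp only [sq_abs] at h1
  have h2 := integral_rpow_mul_exp_neg_mul_rpow (p := 2) (q := j) two_pos
    (lt_of_lt_of_le (by norm_num) (Nat.cast_nonneg j)) hb
  simp only [Real.rpow_natCast, Real.rpow_two] at h2
  rw [h1, h2]; ring

lemma integral_abs_mul_exp_neg_mul_sq {b : ℝ} (hb : 0 < b) :
    ∫ s : ℝ, |s| * Real.exp (-b * s ^ 2) = b⁻¹ := by
  have := integral_abs_pow_mul_exp_neg_mul_sq 1 hb
  simp only [pow_one] at this
  rw [this]
  norm_num [Real.rpow_neg_one]

lemma integral_abs_cube_mul_exp_neg_mul_sq {b : ℝ} (hb : 0 < b) :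
    ∫ s : ℝ, |s| ^ 3 * Real.exp (-b * s ^ 2) = (b ^ 2)⁻¹ := by
  rw [integral_abs_pow_mul_exp_neg_mul_sq 3 hb]
  norm_num [Real.rpow_neg hb.le, Real.Gamma_two]

/-- The two terms are the costs of dropping the cubic phase, which is unimodular and differs from
`1` by at most `|s|³`, and of replacing the algebraic prefactor by `1`, an error of order `|s| /
‖t‖`. The sector condition keeps the prefactor bounded and the Gaussian decaying. -/
lemma norm_saddle_sub_le {κ : ℝ} (hκ : 0 < κ) {t : ℂ} (ht0 : t ≠ 0) (ht : κ * ‖t‖ ≤ t.re)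
    {k : ℤ} (hk : k = 1 ∨ k = 2) (s : ℝ) :
    ‖(1 + (s : ℂ) * Complex.I / t) ^ (-k) *
        Complex.exp (-t * (s : ℂ) ^ 2 - Complex.I * (s : ℂ) ^ 3 / 3)
        - Complex.exp (-t * (s : ℂ) ^ 2)‖
      ≤ (κ ^ 2)⁻¹ * (|s| ^ 3 * Real.exp (-(κ * ‖t‖) * s ^ 2))
        + 2 * (κ ^ 2)⁻¹ / ‖t‖ * (|s| * Real.exp (-(κ * ‖t‖) * s ^ 2)) := by
  have htn : 0 < ‖t‖ := norm_pos_iff.2 ht0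
  have hκ1 : κ ≤ 1 := by
    have := Complex.re_le_norm t
    by_contra h
    nlinarith
  set w : ℂ := 1 + (s : ℂ) * Complex.I / t with hw
  have hwt : w = (t + s * Complex.I) / t := by rw [hw]; field_simp
  have hwn : κ ≤ ‖w‖ := by
    rw [hwt, norm_div, le_div_iff₀ htn]
    refine ht.trans ?_
    have := Complex.re_le_norm (t + s * Complex.I)
    simpa using this
  have hw0 : w ≠ 0 := by
    intro h; rw [h, norm_zero] at hwn; linarith
  have hwi : ‖w⁻¹‖ ≤ κ⁻¹ := by rw [norm_inv]; gcongr
  have hw1 : ‖w⁻¹ - 1‖ ≤ |s| / ‖t‖ * κ⁻¹ := by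
    have : w⁻¹ - 1 = -((s : ℂ) * Complex.I / t) * w⁻¹ := by
      have e : -((s : ℂ) * Complex.I / t) = 1 - w := by rw [hw]; ring
      rw [e, sub_mul, mul_inv_cancel₀ hw0, one_mul]
    rw [this, norm_mul, norm_neg]
    have : ‖(s : ℂ) * Complex.I / t‖ = |s| / ‖t‖ := by simp
    rw [this]; gcongr
  have hκi : 1 ≤ κ⁻¹ := (one_le_inv₀ hκ).2 hκ1
  have hk1 : ‖w ^ (-k)‖ ≤ (κ ^ 2)⁻¹ ∧ ‖w ^ (-k) - 1‖ ≤ 2 * (κ ^ 2)⁻¹ / ‖t‖ * |s| := by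
    have e : 2 * (κ ^ 2)⁻¹ / ‖t‖ * |s| = |s| / ‖t‖ * κ⁻¹ * (2 * κ⁻¹) := by
      rw [← inv_pow]; ring
    rw [e, ← inv_pow]
    have hp : 0 ≤ |s| / ‖t‖ * κ⁻¹ := by positivity
    rcases hk with rfl | rfl
    · rw [zpow_neg_one]
      exact ⟨by nlinarith, by nlinarith⟩
    · have e2 : w ^ (-2 : ℤ) = w⁻¹ ^ 2 := by
        rw [zpow_neg, inv_pow]; norm_cast
      rw [e2, norm_pow]
      refine ⟨by gcongr, ?_⟩
      have : w⁻¹ ^ 2 - 1 = (w⁻¹ - 1) * (w⁻¹ + 1) := by ring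
      rw [this, norm_mul]
      gcongr
      refine (norm_add_le _ _).trans ?_
      rw [norm_one]; linarith
  have hexp : ‖Complex.exp (-t * (s : ℂ) ^ 2)‖ ≤ Real.exp (-(κ * ‖t‖) * s ^ 2) := by
    rw [norm_cexp_neg_mul_sq]
    gcongr
  have hosc : ‖Complex.exp (-(Complex.I * (s : ℂ) ^ 3 / 3)) - 1‖ ≤ |s| ^ 3 := by
    have e : -(Complex.I * (s : ℂ) ^ 3 / 3) = Complex.I * ((-(s ^ 3 / 3) : ℝ) : ℂ) := by
      push_cast; ring
    rw [e]
    refine (Real.norm_exp_I_mul_ofReal_sub_one_le).trans ?_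
    rw [Real.norm_eq_abs, abs_neg, abs_div, abs_pow]
    have : 0 ≤ |s| ^ 3 := by positivity
    norm_num
    linarith
  have hsplit : w ^ (-k) * Complex.exp (-t * (s : ℂ) ^ 2 - Complex.I * (s : ℂ) ^ 3 / 3)
        - Complex.exp (-t * (s : ℂ) ^ 2)
      = (w ^ (-k) * (Complex.exp (-(Complex.I * (s : ℂ) ^ 3 / 3)) - 1) + (w ^ (-k) - 1))
        * Complex.exp (-t * (s : ℂ) ^ 2) := by
    rw [sub_eq_add_neg (-t * (s : ℂ) ^ 2), Complex.exp_add]; ring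
  rw [hsplit, norm_mul]
  calc _ ≤ ((κ ^ 2)⁻¹ * |s| ^ 3 + 2 * (κ ^ 2)⁻¹ / ‖t‖ * |s|) * Real.exp (-(κ * ‖t‖) * s ^ 2) := by
        gcongr
        refine (norm_add_le _ _).trans (add_le_add ?_ hk1.2)
        rw [norm_mul]
        exact mul_le_mul hk1.1 hosc (norm_nonneg _) (by positivity)
    _ = _ := by ring

/-- The third Gaussian moment is `(κ‖t‖)⁻²` and the first is `(κ‖t‖)⁻¹`, the latter carrying an
extra `‖t‖⁻¹`. Against the main term of order `‖t‖^{-1/2}` this is a relative error `‖t‖^{-3/2}`. -/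
lemma norm_saddleIntegral_sub_le {κ : ℝ} (hκ : 0 < κ) {t : ℂ} (ht0 : t ≠ 0) (ht : κ * ‖t‖ ≤ t.re)
    {k : ℤ} (hk : k = 1 ∨ k = 2) :
    ‖saddleIntegral k t - (Real.pi / t) ^ (1 / 2 : ℂ)‖
      ≤ ((κ ^ 4)⁻¹ + 2 * (κ ^ 3)⁻¹) * (‖t‖ ^ 2)⁻¹ := by
  have htn : 0 < ‖t‖ := norm_pos_iff.2 ht0
  have hb : 0 < κ * ‖t‖ := by positivity
  have hre : 0 < t.re := hb.trans_le ht
  have hg : Integrable fun s : ℝ => Complex.exp (-t * (s : ℂ) ^ 2) :=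
    integrable_cexp_neg_mul_sq hre
  have h3 := integrable_abs_pow_mul_exp_neg_mul_sq 3 hb
  have h1 := integrable_abs_pow_mul_exp_neg_mul_sq 1 hb
  simp only [pow_one] at h1
  unfold saddleIntegral
  rw [← integral_gaussian_complex hre, ← integral_sub (saddle_integrable k hre) hg]
  refine (norm_integral_le_of_norm_le ((h3.const_mul _).add (h1.const_mul _))
    (ae_of_all _ fun s => norm_saddle_sub_le hκ ht0 ht hk s)).trans (le_of_eq ?_)
  rw [integral_add' (h3.const_mul _) (h1.const_mul _), integral_const_mul, integral_const_mul,
    integral_abs_mul_exp_neg_mul_sq hb, integral_abs_cube_mul_exp_neg_mul_sq hb]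
  field_simp

/-- In a sector `|arg t| ≤ arccos κ < π / 2`, the quotient `Ai(1, t²) / Ai(2, t²)` is
`-t (1 + O(|t|^{-3/2}))`. -/
theorem airy_quotient_asymptotics {κ : ℝ} (hκ : 0 < κ) :
    ∃ C > 0, ∃ R > 0, ∀ t : ℂ, R ≤ ‖t‖ → κ * ‖t‖ ≤ t.re →
      airy 2 (t ^ 2) ≠ 0 ∧
      ∃ ρ : ℂ, airy 1 (t ^ 2) / airy 2 (t ^ 2) = -t * (1 + ρ) ∧
        ‖ρ‖ ≤ C * ‖t‖ ^ (-(3 / 2) : ℝ) := by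
  set B : ℝ := (κ ^ 4)⁻¹ + 2 * (κ ^ 3)⁻¹ with hB
  have hB0 : 0 < B := by positivity
  refine ⟨4 * B, by positivity, max 1 (2 * B), by positivity, fun t hR ht => ?_⟩
  have h1t : 1 ≤ ‖t‖ := (le_max_left _ _).trans hR
  have hBt : 2 * B ≤ ‖t‖ := (le_max_right _ _).trans hR
  have htn : 0 < ‖t‖ := by linarith
  have ht0 : t ≠ 0 := norm_pos_iff.1 htn
  have hre : 0 < t.re := (by positivity : 0 < κ * ‖t‖).trans_le ht
  set g : ℂ := (Real.pi / t) ^ (1 / 2 : ℂ) with hg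
  have e1 := norm_saddleIntegral_sub_le hκ ht0 ht (k := 1) (Or.inl rfl)
  have e2 := norm_saddleIntegral_sub_le hκ ht0 ht (k := 2) (Or.inr rfl)
  rw [← hB, ← hg] at e1 e2
  set N1 := saddleIntegral 1 t
  set N2 := saddleIntegral 2 t
  have hgn : ‖t‖ ^ (-(1 / 2) : ℝ) ≤ ‖g‖ := by
    have : (1 / 2 : ℂ) = ((1 / 2 : ℝ) : ℂ) := by push_cast; rfl
    rw [hg, this, Complex.norm_cpow_real, norm_div, Complex.norm_real,
      Real.norm_of_nonneg Real.pi_pos.le, Real.rpow_neg htn.le, ← Real.inv_rpow htn.le]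
    refine Real.rpow_le_rpow (by positivity) ?_ (by norm_num)
    rw [← one_div]
    gcongr
    linarith [Real.pi_gt_three]
  have hpow : (‖t‖ ^ 2)⁻¹ = ‖t‖ ^ (-(1 / 2) : ℝ) * ‖t‖ ^ (-(3 / 2) : ℝ) := by
    rw [← Real.rpow_add htn, ← Real.rpow_natCast, ← Real.rpow_neg htn.le]
    norm_num
  set x := ‖t‖ ^ (-(1 / 2) : ℝ) with hx
  have hx0 : 0 < x := Real.rpow_pos_of_pos htn _
  set y := ‖t‖ ^ (-(3 / 2) : ℝ) with hy
  have hy0 : 0 < y := Real.rpow_pos_of_pos htn _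
  have hy1 : y ≤ ‖t‖⁻¹ := by
    rw [hy, ← Real.rpow_neg_one]
    exact Real.rpow_le_rpow_of_exponent_le h1t (by norm_num)
  have hBy : B * y ≤ 1 / 2 := by
    have : B * y ≤ B * ‖t‖⁻¹ := by gcongr
    refine this.trans ?_
    rw [← div_eq_mul_inv, div_le_iff₀ htn]
    linarith
  rw [hpow] at e1 e2
  have hN2 : x / 2 ≤ ‖N2‖ := by
    have h3 := norm_sub_norm_le g N2
    rw [norm_sub_rev] at h3
    nlinarith
  have hN20 : N2 ≠ 0 := norm_pos_iff.1 (by linarith)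
  have hpi : (2 * (Real.pi : ℂ))⁻¹ ≠ 0 := by
    simp [Real.pi_ne_zero]
  have hnt : -t ≠ 0 := neg_ne_zero.2 ht0
  have hex := Complex.exp_ne_zero (-(2 / 3) * t ^ 3)
  refine ⟨?_, N1 / N2 - 1, ?_, ?_⟩
  · rw [airy_sq_eq 2 hre]
    exact mul_ne_zero (mul_ne_zero hpi (mul_ne_zero hex (zpow_ne_zero _ hnt))) hN20
  · rw [airy_sq_eq 1 hre, airy_sq_eq 2 hre]
    -- The exponential prefactors cancel in the quotient; the differing powers of `-t` produce the
    -- leading factor.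
    have z1 : (-t) ^ (-1 : ℤ) = -t * (-t) ^ (-2 : ℤ) := by
      rw [← zpow_one_add₀ hnt]; norm_num
    have z2 := zpow_ne_zero (-2) hnt
    rw [z1, mul_div_mul_comm, add_sub_cancel]
    congr 1
    field_simp
  · have : N1 / N2 - 1 = ((N1 - g) - (N2 - g)) / N2 := by field_simp; ring
    rw [this, norm_div, div_le_iff₀ (by linarith)]
    have := norm_sub_le (N1 - g) (N2 - g)
    have h4 : 4 * B * y * (x / 2) ≤ 4 * B * y * ‖N2‖ := by gcongr
    nlinarith

/-! ### Zeros of perturbed affine functions -/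

/-- A holomorphic function close to an affine one on a disk has exactly one zero in the concentric
disk of half the radius. -/
theorem existsUnique_zero_of_norm_sub_affine_le {F : ℂ → ℂ} {a κ : ℂ} {r : ℝ} (hr : 0 < r)
    (hκ : κ ≠ 0) (hF : DifferentiableOn ℂ F (Metric.closedBall a (2 * r)))
    (hb : ∀ c ∈ Metric.closedBall a (2 * r), ‖F c - κ * (a - c)‖ ≤ ‖κ‖ * r / 4) :
    (∃! c, c ∈ Metric.closedBall a r ∧ F c = 0) ∧
      ∀ c ∈ Metric.sphere a r, 1 / 2 * (‖κ‖ * r) ≤ ‖F c‖ := by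
  have hκn : 0 < ‖κ‖ := norm_pos_iff.2 hκ
  -- This is `c + κ⁻¹ F c`, a Newton step with the derivative frozen at `-κ`: its fixed points are
  -- the zeros of `F`.
  set T : ℂ → ℂ := fun c => a + κ⁻¹ * (F c - κ * (a - c)) with hT
  have hzero : ∀ c, F c = 0 ↔ T c = c := by
    intro c
    have : T c - c = κ⁻¹ * F c := by rw [hT]; field_simp; ring
    rw [← sub_eq_zero (b := c), this]
    simp [hκ]
  have hTd : DifferentiableOn ℂ T (Metric.closedBall a (2 * r)) := by
    rw [hT]; fun_prop
  have hTb : ∀ c ∈ Metric.closedBall a (2 * r), ‖T c - a‖ ≤ r / 4 := by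
    intro c hc
    rw [hT]
    simp only [add_sub_cancel_left]
    rw [norm_mul, norm_inv]
    calc ‖κ‖⁻¹ * ‖F c - κ * (a - c)‖ ≤ ‖κ‖⁻¹ * (‖κ‖ * r / 4) := by gcongr; exact hb c hc
      _ = r / 4 := by field_simp
  have hsub : Metric.closedBall a r ⊆ Metric.closedBall a (2 * r) :=
    Metric.closedBall_subset_closedBall (by linarith)
  have hsub2 : ∀ c ∈ Metric.closedBall a r,
      Metric.closedBall c r ⊆ Metric.closedBall a (2 * r) := fun c hc =>
    Metric.closedBall_subset_closedBall' (by rw [Metric.mem_closedBall] at hc; linarith)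
  -- Cauchy's estimate on circles of radius `r`, which stay in the doubled disk, turns the deviation
  -- `r / 4` into the contraction constant `1 / 4`.
  have hderiv : ∀ c ∈ Metric.closedBall a r, ‖deriv T c‖ ≤ 1 / 4 := by
    intro c hc
    have h1 : DiffContOnCl ℂ (fun c => T c - a) (Metric.ball c r) := by
      refine DifferentiableOn.diffContOnCl ?_
      rw [closure_ball _ hr.ne']
      exact (hTd.mono (hsub2 c hc)).sub_const a
    have h2 := Complex.norm_deriv_le_of_forall_mem_sphere_norm_le hr h1
      (fun z hz => hTb z (hsub2 c hc (Metric.sphere_subset_closedBall hz)))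
    rw [deriv_sub_const] at h2
    refine h2.trans (le_of_eq ?_)
    field_simp
  have hdiff : ∀ c ∈ Metric.closedBall a r, DifferentiableAt ℂ T c := fun c hc =>
    hTd.differentiableAt (mem_of_superset (Metric.closedBall_mem_nhds c hr) (hsub2 c hc))
  have hlip : LipschitzOnWith (1 / 4) T (Metric.closedBall a r) := by
    refine Convex.lipschitzOnWith_of_nnnorm_deriv_le (𝕜 := ℂ) hdiff (fun c hc => ?_)
      (convex_closedBall a r)
    rw [← NNReal.coe_le_coe]
    simpa using hderiv c hc
  have hmaps : MapsTo T (Metric.closedBall a r) (Metric.closedBall a r) := by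
    intro c hc
    rw [Metric.mem_closedBall, dist_eq_norm]
    have := hTb c (hsub hc)
    linarith
  have hcontr : ContractingWith (1 / 4) (hmaps.restrict T _ _) :=
    ⟨by rw [← NNReal.coe_lt_coe]; norm_num, hlip.mapsToRestrict hmaps⟩
  refine ⟨?_, fun c hc => ?_⟩
  · obtain ⟨y, hy, hfix, -⟩ := hcontr.exists_fixedPoint' (Metric.isClosed_closedBall.isComplete)
      hmaps (Metric.mem_closedBall_self hr.le) (edist_ne_top _ _)
    refine ⟨y, ⟨hy, (hzero y).2 hfix⟩, fun z ⟨hz, hz0⟩ => ?_⟩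
    have h1 := hlip.dist_le_mul z hz y hy
    rw [(hzero z).1 hz0, hfix.eq] at h1
    have h2 : (((1 / 4 : NNReal)) : ℝ) = 1 / 4 := by norm_num
    rw [h2] at h1
    have h3 := dist_nonneg (x := z) (y := y)
    exact dist_le_zero.1 (by linarith)
  · have h1 := hb c (hsub (Metric.sphere_subset_closedBall hc))
    have h2 : ‖κ * (a - c)‖ = ‖κ‖ * r := by
      rw [norm_mul, ← dist_eq_norm, dist_comm, Metric.mem_sphere.1 hc]
    have h3 := norm_sub_norm_le (κ * (a - c)) (F c)
    rw [norm_sub_rev, h2] at h3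
    nlinarith

/-! ### Elementary properties of boundary layer profiles -/

namespace IsBoundaryLayerProfile

variable {m : ℝ} {U : ℝ → ℝ}

lemma hasDerivWithinAt (hU : IsBoundaryLayerProfile m U) {Y : ℝ} (hY : 0 ≤ Y) :
    HasDerivWithinAt U (profileDeriv 1 U Y) (Ici 0) Y := by
  have h := hU.contDiffOn.differentiableOn (by norm_num) Y hY
  unfold profileDeriv
  rw [iteratedDerivWithin_one]
  exact h.hasDerivWithinAt

lemma hasDerivAt (hU : IsBoundaryLayerProfile m U) {Y : ℝ} (hY : 0 < Y) :
    HasDerivAt U (profileDeriv 1 U Y) Y :=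
  (hU.hasDerivWithinAt hY.le).hasDerivAt (Ici_mem_nhds hY)

lemma continuousOn (hU : IsBoundaryLayerProfile m U) : ContinuousOn U (Ici 0) :=
  hU.contDiffOn.continuousOn

lemma continuousOn_deriv (hU : IsBoundaryLayerProfile m U) :
    ContinuousOn (profileDeriv 1 U) (Ici 0) :=
  hU.contDiffOn.continuousOn_iteratedDerivWithin (by norm_num) (uniqueDiffOn_Ici 0)

lemma deriv_pos (hU : IsBoundaryLayerProfile m U) {Y : ℝ} (hY : 0 ≤ Y) :
    0 < profileDeriv 1 U Y := by
  obtain ⟨s₀, -, s₁, hs₁, s₂, -, h⟩ := hU.exp_decay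
  exact (by positivity : 0 < s₁ * Real.exp (-s₀ * Y)).trans_le (h Y hY).1

lemma monotoneOn (hU : IsBoundaryLayerProfile m U) : MonotoneOn U (Ici 0) := by
  refine monotoneOn_of_hasDerivWithinAt_nonneg (f' := profileDeriv 1 U) (convex_Ici 0)
    hU.continuousOn (fun x hx => ?_) (fun x hx => ?_)
  · rw [interior_Ici] at hx ⊢
    exact (hU.hasDerivAt hx).hasDerivWithinAt
  · rw [interior_Ici] at hx
    exact (hU.deriv_pos (le_of_lt hx)).le

lemma nonneg (hU : IsBoundaryLayerProfile m U) {Y : ℝ} (hY : 0 ≤ Y) : 0 ≤ U Y := by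
  have := hU.monotoneOn (mem_Ici.2 le_rfl) hY hY
  rwa [hU.zero] at this

lemma le_one (hU : IsBoundaryLayerProfile m U) {Y : ℝ} (hY : 0 ≤ Y) : U Y ≤ 1 := by
  refine ge_of_tendsto hU.tendsto_one ?_
  filter_upwards [eventually_ge_atTop Y] with X hX
  exact hU.monotoneOn hY (mem_Ici.2 (hY.trans hX)) hX

/-- The exponential lower bound on `U'` is uniformly positive on `[0, 1]`. This controls `|U - c|`
from below away from the wall. -/
lemma exists_linear_lower_bound (hU : IsBoundaryLayerProfile m U) :
    ∃ s > 0, ∀ X ∈ Icc (0 : ℝ) 1, s * X ≤ U X := by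
  obtain ⟨s₀, hs₀, s₁, hs₁, s₂, -, h⟩ := hU.exp_decay
  refine ⟨s₁ * Real.exp (-s₀), by positivity, fun X hX => ?_⟩
  have hm : MonotoneOn (fun X => U X - s₁ * Real.exp (-s₀) * X) (Icc 0 1) := by
    refine monotoneOn_of_hasDerivWithinAt_nonneg
      (f' := fun X => profileDeriv 1 U X - s₁ * Real.exp (-s₀)) (convex_Icc 0 1)
      ((hU.continuousOn.mono Icc_subset_Ici_self).sub (by fun_prop)) (fun x hx => ?_)
      (fun x hx => ?_)
    · rw [interior_Icc] at hx ⊢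
      have h1 := (hU.hasDerivAt hx.1).sub ((hasDerivAt_id x).const_mul (s₁ * Real.exp (-s₀)))
      rw [mul_one] at h1
      exact h1.hasDerivWithinAt
    · rw [interior_Icc] at hx
      have h1 := (h x hx.1.le).1
      have h2 : Real.exp (-s₀) ≤ Real.exp (-s₀ * x) := by
        gcongr
        nlinarith [hx.2]
      have : s₁ * Real.exp (-s₀) ≤ s₁ * Real.exp (-s₀ * x) := by gcongr
      linarith
  have := hm (left_mem_Icc.2 zero_le_one) hX hX.1
  simp only [hU.zero, mul_zero, sub_zero] at this
  linarith

/-- `U'(0) = 1` and `U''` is bounded on `[0, 1]`. The gained factor `X` reduces the double pole of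
`(U - c)⁻²` to a logarithmic singularity. -/
lemma exists_deriv_lipschitz (hU : IsBoundaryLayerProfile m U) :
    ∃ C, ∀ X ∈ Icc (0 : ℝ) 1, |1 - profileDeriv 1 U X| ≤ C * X := by
  have hd : ∀ x ∈ Ici (0 : ℝ), HasDerivWithinAt (profileDeriv 1 U) (profileDeriv 2 U x) (Ici 0) x := by
    intro x hx
    have h := hU.contDiffOn.differentiableOn_iteratedDerivWithin (m := 1) (by norm_num)
      (uniqueDiffOn_Ici 0) x hx
    refine h.hasDerivWithinAt.congr_deriv ?_
    exact (congrFun (iteratedDerivWithin_succ (n := 1)) x).symm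
  have hc : ContinuousOn (profileDeriv 2 U) (Icc 0 1) :=
    (hU.contDiffOn.continuousOn_iteratedDerivWithin (by norm_num) (uniqueDiffOn_Ici 0)).mono
      Icc_subset_Ici_self
  obtain ⟨C, hC⟩ := isCompact_Icc.exists_bound_of_continuousOn hc
  refine ⟨C, fun X hX => ?_⟩
  have := Convex.norm_image_sub_le_of_norm_hasDerivWithin_le (s := Icc (0 : ℝ) 1)
    (fun x hx => (hd x hx.1).mono Icc_subset_Ici_self) hC (convex_Icc 0 1)
    (left_mem_Icc.2 zero_le_one) hX
  rw [hU.deriv_zero, Real.norm_eq_abs, Real.norm_eq_abs, sub_zero, abs_of_nonneg hX.1,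
    abs_sub_comm] at this
  exact this

lemma integrableOn_deriv (hU : IsBoundaryLayerProfile m U) :
    IntegrableOn (profileDeriv 1 U) (Ioi 0) := by
  refine integrableOn_Ioi_deriv_of_nonneg (l := 1) (hU.continuousOn 0 (mem_Ici.2 le_rfl))
    (fun x hx => hU.hasDerivAt hx) (fun x hx => (hU.deriv_pos (le_of_lt hx)).le) hU.tendsto_one

end IsBoundaryLayerProfile

/-! ### The slow mode at the boundary -/

section SlowMode

variable {m α : ℝ} {U : ℝ → ℝ} {c : ℂ}

lemma profile_sub_ne_zero (hc : 0 < c.im) (x : ℝ) : (x : ℂ) - c ≠ 0 := by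
  intro h
  have := congrArg Complex.im h
  simp at this
  linarith

/-- Applied at `x = U Y` and at `x = 1`, so that the single condition `m (1 + ‖c‖) < 1` handles both
`A` and `A_∞`. -/
lemma one_sub_sq_le_norm (hm : 0 ≤ m) {x r : ℝ} (hx : x ∈ Icc (0 : ℝ) 1) (hr : ‖c‖ ≤ r) :
    1 - (m * (1 + r)) ^ 2 ≤ ‖1 - (m : ℂ) ^ 2 * ((x : ℂ) - c) ^ 2‖ := by
  have h1 : ‖(x : ℂ) - c‖ ≤ 1 + r := by
    refine (norm_sub_le _ _).trans ?_
    rw [Complex.norm_real, Real.norm_of_nonneg hx.1]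
    linarith [hx.2]
  have h2 : ‖(m : ℂ) ^ 2 * ((x : ℂ) - c) ^ 2‖ ≤ (m * (1 + r)) ^ 2 := by
    rw [← mul_pow, norm_pow, norm_mul, Complex.norm_real, Real.norm_of_nonneg hm]
    gcongr
  have h3 := norm_sub_norm_le (1 : ℂ) ((m : ℂ) ^ 2 * ((x : ℂ) - c) ^ 2)
  rw [norm_one] at h3
  linarith

lemma coeffA_norm_ge (hU : IsBoundaryLayerProfile m U) (hm : 0 ≤ m) {Y : ℝ} (hY : 0 ≤ Y) :
    1 - (m * (1 + ‖c‖)) ^ 2 ≤ ‖coeffA m U c Y‖ :=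
  one_sub_sq_le_norm hm ⟨hU.nonneg hY, hU.le_one hY⟩ le_rfl

lemma coeffA_ne_zero (hU : IsBoundaryLayerProfile m U) (hm : 0 ≤ m) (hmc : m * (1 + ‖c‖) < 1)
    {Y : ℝ} (hY : 0 ≤ Y) : coeffA m U c Y ≠ 0 := by
  have h1 := coeffA_norm_ge (c := c) hU hm hY
  have h2 : (m * (1 + ‖c‖)) ^ 2 < 1 := pow_lt_one₀ (by positivity) hmc two_ne_zero
  exact norm_pos_iff.1 (by linarith)

lemma coeffAInfty_ne_zero (hm : 0 ≤ m) (hmc : m * (1 + ‖c‖) < 1) : coeffAInfty m c ≠ 0 := by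
  have h1 := one_sub_sq_le_norm (c := c) hm (x := 1) ⟨zero_le_one, le_rfl⟩ le_rfl
  have h2 : (m * (1 + ‖c‖)) ^ 2 < 1 := pow_lt_one₀ (by positivity) hmc two_ne_zero
  rw [Complex.ofReal_one] at h1
  exact norm_pos_iff.1 (by unfold coeffAInfty; linarith)

lemma continuousOn_coeffA (hU : IsBoundaryLayerProfile m U) :
    ContinuousOn (coeffA m U c) (Ici 0) := by
  have := Complex.continuous_ofReal.comp_continuousOn hU.continuousOn
  unfold coeffA
  exact continuousOn_const.sub (continuousOn_const.mul ((this.sub continuousOn_const).pow 2))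

lemma coeffA_hasDerivWithinAt (hU : IsBoundaryLayerProfile m U) {Y : ℝ} (hY : 0 ≤ Y) :
    HasDerivWithinAt (coeffA m U c)
      (-(2 * (m : ℂ) ^ 2 * ((U Y : ℂ) - c) * (profileDeriv 1 U Y : ℂ))) (Ici 0) Y := by
  have h := (((hU.hasDerivWithinAt hY).ofReal_comp.sub_const c).pow 2).const_mul ((m : ℂ) ^ 2)
  refine (h.const_sub 1).congr_deriv ?_
  push_cast; ring

/-- The primitive of `(U - c) A⁻² U'` that vanishes at infinity, up to sign. -/
def tailIntegral (m : ℝ) (U : ℝ → ℝ) (c : ℂ) (Y : ℝ) : ℂ :=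
  ((coeffAInfty m c)⁻¹ - (coeffA m U c Y)⁻¹) / (2 * (m : ℂ) ^ 2)

/-- From `A' = -2 m² (U - c) U'`, the derivative of `1 / A` is `2 m² (U - c) A⁻² U'`. -/
lemma tailIntegral_hasDerivWithinAt (hU : IsBoundaryLayerProfile m U) (hm : 0 < m)
    (hmc : m * (1 + ‖c‖) < 1) {Y : ℝ} (hY : 0 ≤ Y) :
    HasDerivWithinAt (tailIntegral m U c)
      (-(((U Y : ℂ) - c) * (coeffA m U c Y ^ 2)⁻¹ * (profileDeriv 1 U Y : ℂ))) (Ici 0) Y := by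
  have hA := coeffA_ne_zero hU hm.le hmc hY
  have hm0 : (m : ℂ) ≠ 0 := by exact_mod_cast hm.ne'
  have h := (((coeffA_hasDerivWithinAt (c := c) hU hY).inv hA).const_sub
    (coeffAInfty m c)⁻¹).div_const (2 * (m : ℂ) ^ 2)
  refine h.congr_deriv ?_
  field_simp

lemma integrableOn_tail (hU : IsBoundaryLayerProfile m U) (hm : 0 < m)
    (hmc : m * (1 + ‖c‖) < 1) :
    IntegrableOn (fun X => ((U X : ℂ) - c) * (coeffA m U c X ^ 2)⁻¹ * (profileDeriv 1 U X : ℂ))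
      (Ioi 0) := by
  have h2 : (m * (1 + ‖c‖)) ^ 2 < 1 := pow_lt_one₀ (by positivity) hmc two_ne_zero
  set a := 1 - (m * (1 + ‖c‖)) ^ 2 with ha
  have ha0 : 0 < a := by linarith
  have hUc := Complex.continuous_ofReal.comp_continuousOn hU.continuousOn
  have hUd := Complex.continuous_ofReal.comp_continuousOn hU.continuousOn_deriv
  refine Integrable.mono' ((hU.integrableOn_deriv).const_mul ((1 + ‖c‖) * (a ^ 2)⁻¹)) ?_ ?_
  · refine ContinuousOn.aestronglyMeasurable ?_ measurableSet_Ioi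
    refine ContinuousOn.mono ?_ Ioi_subset_Ici_self
    exact ((hUc.sub continuousOn_const).mul (((continuousOn_coeffA hU).pow 2).inv₀
      (fun x hx => pow_ne_zero 2 (coeffA_ne_zero hU hm.le hmc hx)))).mul hUd
  · refine (ae_restrict_mem measurableSet_Ioi).mono fun X hX => ?_
    have hX0 : 0 ≤ X := le_of_lt hX
    have e1 : ‖(U X : ℂ) - c‖ ≤ 1 + ‖c‖ := by
      refine (norm_sub_le _ _).trans ?_
      rw [Complex.norm_real, Real.norm_of_nonneg (hU.nonneg hX0)]
      linarith [hU.le_one hX0]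
    have e2 := coeffA_norm_ge (c := c) hU hm.le hX0
    rw [norm_mul, norm_mul, norm_inv, norm_pow, Complex.norm_real,
      Real.norm_of_nonneg (hU.deriv_pos hX0).le]
    have := (hU.deriv_pos hX0).le
    gcongr

lemma integral_Ioi_tail (hU : IsBoundaryLayerProfile m U) (hm : 0 < m)
    (hmc : m * (1 + ‖c‖) < 1) {Y : ℝ} (hY : 0 ≤ Y) :
    ∫ X in Ioi Y, ((U X : ℂ) - c) * (coeffA m U c X ^ 2)⁻¹ * (profileDeriv 1 U X : ℂ)
      = tailIntegral m U c Y := by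
  have hd := fun {Y : ℝ} (hY : 0 ≤ Y) => tailIntegral_hasDerivWithinAt hU hm hmc hY
  have hlim : Tendsto (fun Y => -tailIntegral m U c Y) atTop (𝓝 0) := by
    have h1 : Tendsto (coeffA m U c) atTop (𝓝 (coeffAInfty m c)) := by
      have := (Complex.continuous_ofReal.tendsto 1).comp hU.tendsto_one
      exact (((this.sub_const c).pow 2).const_mul ((m : ℂ) ^ 2)).const_sub 1
    have h2 := (((h1.inv₀ (coeffAInfty_ne_zero hm.le hmc)).const_sub
      (coeffAInfty m c)⁻¹).div_const (2 * (m : ℂ) ^ 2)).neg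
    simp only [sub_self, zero_div, neg_zero] at h2
    exact h2
  have := integral_Ioi_of_hasDerivAt_of_tendsto (a := Y) (f := fun Y => -tailIntegral m U c Y)
    (f' := fun X => ((U X : ℂ) - c) * (coeffA m U c X ^ 2)⁻¹ * (profileDeriv 1 U X : ℂ))
    ((hd hY).continuousWithinAt.mono (Ici_subset_Ici.2 hY)).neg
    (fun x hx => by
      have hx0 : 0 < x := hY.trans_lt hx
      exact ((hd hx0.le).hasDerivAt (Ici_mem_nhds hx0)).neg.congr_deriv (neg_neg _))
    ((integrableOn_tail hU hm hmc).mono_set (Ioi_subset_Ioi hY)) hlim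
  rw [this]; ring

lemma continuousOn_inv_sq (hU : IsBoundaryLayerProfile m U) (hc : 0 < c.im) :
    ContinuousOn (fun X => 1 / ((U X : ℂ) - c) ^ 2) (Ici 0) := by
  have hUc := Complex.continuous_ofReal.comp_continuousOn hU.continuousOn
  exact continuousOn_const.div ((hUc.sub continuousOn_const).pow 2)
    fun x _ => pow_ne_zero 2 (profile_sub_ne_zero hc _)

lemma intervalIntegrable_inv_sq (hU : IsBoundaryLayerProfile m U) (hc : 0 < c.im) :
    IntervalIntegrable (fun X => 1 / ((U X : ℂ) - c) ^ 2) volume 0 1 :=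
  ((continuousOn_inv_sq hU hc).mono (by
    rw [uIcc_of_le zero_le_one]; exact Icc_subset_Ici_self)).intervalIntegrable

lemma continuousOn_phiMinus (hU : IsBoundaryLayerProfile m U) (hc : 0 < c.im) :
    ContinuousOn (phiMinus m U c) (Icc 0 1) := by
  have hsub : Icc (0 : ℝ) 1 ⊆ Ici 0 := Icc_subset_Ici_self
  have hUc := (Complex.continuous_ofReal.comp_continuousOn hU.continuousOn).mono hsub
  have h1 := intervalIntegral.continuousOn_primitive_interval' (intervalIntegrable_inv_sq hU hc)
    (right_mem_uIcc)
  rw [uIcc_of_le zero_le_one] at h1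
  have h2 := hUc.sub (continuousOn_const (c := c))
  exact (h2.mul h1).sub ((continuousOn_const.mul h2).mul Complex.continuous_ofReal.continuousOn)

/-- The integral `∫₀¹ dX / (U - c)²`, which governs the slow mode at the boundary. -/
def criticalIntegral (U : ℝ → ℝ) (c : ℂ) : ℂ :=
  ∫ X in (0 : ℝ)..1, 1 / ((U X : ℂ) - c) ^ 2

lemma phiMinus_zero (hU : IsBoundaryLayerProfile m U) :
    phiMinus m U c 0 = c * criticalIntegral U c := by
  unfold phiMinus criticalIntegral
  rw [intervalIntegral.integral_symm, hU.zero]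
  simp

lemma phiMinus_hasDerivWithinAt_zero (hU : IsBoundaryLayerProfile m U) (hc : 0 < c.im) :
    HasDerivWithinAt (phiMinus m U c) (-criticalIntegral U c - 1 / c + (m : ℂ) ^ 2 * c)
      (Ici 0) 0 := by
  have hc0 : c ≠ 0 := by rintro rfl; simp at hc
  have h1 : HasDerivWithinAt (fun Y : ℝ => (U Y : ℂ) - c) 1 (Ici 0) 0 := by
    have := ((hU.hasDerivWithinAt le_rfl).ofReal_comp.sub_const c)
    rwa [hU.deriv_zero, Complex.ofReal_one] at this
  have h2 : HasDerivWithinAt (fun Y : ℝ => ∫ X in (1 : ℝ)..Y, 1 / ((U X : ℂ) - c) ^ 2)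
      (1 / ((U 0 : ℂ) - c) ^ 2) (Ici 0) 0 := by
    refine intervalIntegral.integral_hasDerivWithinAt_right (t := Ioi 0)
      (intervalIntegrable_inv_sq hU hc).symm ?_ ?_
    · exact ((continuousOn_inv_sq hU hc).mono Ioi_subset_Ici_self).stronglyMeasurableAtFilter_nhdsWithin
        measurableSet_Ioi 0
    · exact (continuousOn_inv_sq hU hc 0 (mem_Ici.2 le_rfl)).mono Ioi_subset_Ici_self
  have h3 : HasDerivWithinAt (fun Y : ℝ => (Y : ℂ)) 1 (Ici 0) 0 :=
    (hasDerivAt_id (0 : ℝ)).ofReal_comp.hasDerivWithinAt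
  refine ((h1.mul h2).sub ((h1.const_mul ((m : ℂ) ^ 2)).mul h3)).congr_deriv ?_
  rw [intervalIntegral.integral_symm, hU.zero]
  unfold criticalIntegral
  simp
  field_simp
  ring

/-- The product `e^{-β(Y-X)} e^{-βX}` does not depend on `X`, and the factor `(U X - c)⁻¹` of the
kernel cancels `φ₊(X)`. What remains splits at `X = Y`, and the unbounded piece is the elementary
tail integral, so no decay of `e^{-βY}` is needed. The restriction to `[0, 1]` suffices since only
the germ at `Y = 0` matters. -/
lemma corrector_eq (hU : IsBoundaryLayerProfile m U) (hm : 0 < m) (hc : 0 < c.im)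
    (hmc : m * (1 + ‖c‖) < 1) {Y : ℝ} (hY : Y ∈ Icc (0 : ℝ) 1) :
    corrector m α U c Y = -2 * Complex.exp (-decayRate m α c * (Y : ℂ)) *
      (((U Y : ℂ) - c) * (∫ X in (0 : ℝ)..Y,
          phiMinus m U c X * (coeffA m U c X ^ 2)⁻¹ * (profileDeriv 1 U X : ℂ))
        + phiMinus m U c Y * tailIntegral m U c Y) := by
  set β := decayRate m α c
  have hexp : ∀ X : ℝ, Complex.exp (-β * ((Y : ℂ) - X)) * Complex.exp (-β * X)
      = Complex.exp (-β * Y) := by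
    intro X; rw [← Complex.exp_add]; congr 1; ring
  have hne := fun x : ℝ => profile_sub_ne_zero hc x
  have hI1 : ∀ X ∈ Ioc 0 Y, greenFn m α U c X Y * (coeffA m U c X ^ 2)⁻¹
      * (profileDeriv 1 U X : ℂ) * phiPlusAlpha m α U c X
      = -(Complex.exp (-β * (Y : ℂ)) * ((U Y : ℂ) - c)) *
        (phiMinus m U c X * (coeffA m U c X ^ 2)⁻¹ * (profileDeriv 1 U X : ℂ)) := by
    intro X hX
    -- At the endpoint `X = Y` the second branch of the kernel applies, but both agree on the
    -- diagonal.
    have : (if X < Y then phiPlus U c Y * phiMinus m U c X else phiPlus U c X * phiMinus m U c Y)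
        = ((U Y : ℂ) - c) * phiMinus m U c X := by
      split_ifs with h
      · rfl
      · rw [le_antisymm hX.2 (not_lt.1 h)]; rfl
    unfold greenFn phiPlusAlpha
    rw [this, phiPlus, ← hexp X]
    have := hne (U X)
    change -(_ - c)⁻¹ * (Complex.exp (-β * _) * _) * _ * _ * (Complex.exp (-β * _) * _) = _
    generalize Complex.exp (-β * ((Y : ℂ) - X)) = E₁
    generalize Complex.exp (-β * (X : ℂ)) = E₂
    field_simp
  have hI2 : ∀ X ∈ Ioi Y, greenFn m α U c X Y * (coeffA m U c X ^ 2)⁻¹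
      * (profileDeriv 1 U X : ℂ) * phiPlusAlpha m α U c X
      = -(Complex.exp (-β * (Y : ℂ)) * phiMinus m U c Y) *
        (((U X : ℂ) - c) * (coeffA m U c X ^ 2)⁻¹ * (profileDeriv 1 U X : ℂ)) := by
    intro X hX
    unfold greenFn phiPlusAlpha phiPlus
    rw [if_neg (not_lt.2 (le_of_lt hX)), ← hexp X]
    have := hne (U X)
    change -(_ - c)⁻¹ * (Complex.exp (-β * _) * _) * _ * _ * (Complex.exp (-β * _) * _) = _
    generalize Complex.exp (-β * ((Y : ℂ) - X)) = E₁
    generalize Complex.exp (-β * (X : ℂ)) = E₂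
    field_simp
  have hint1 : IntegrableOn (fun X => phiMinus m U c X * (coeffA m U c X ^ 2)⁻¹
      * (profileDeriv 1 U X : ℂ)) (Ioc 0 Y) := by
    have hsub : Icc (0 : ℝ) Y ⊆ Icc 0 1 := Icc_subset_Icc_right hY.2
    have hUd := Complex.continuous_ofReal.comp_continuousOn hU.continuousOn_deriv
    have : ContinuousOn (fun X => phiMinus m U c X * (coeffA m U c X ^ 2)⁻¹
        * (profileDeriv 1 U X : ℂ)) (Icc 0 Y) :=
      (((continuousOn_phiMinus hU hc).mono hsub).mul
        ((((continuousOn_coeffA hU).mono Icc_subset_Ici_self).pow 2).inv₀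
        (fun x hx => pow_ne_zero 2 (coeffA_ne_zero hU hm.le hmc hx.1)))).mul
        (hUd.mono Icc_subset_Ici_self)
    exact (this.integrableOn_Icc).mono_set Ioc_subset_Icc_self
  have hint2 := (integrableOn_tail hU hm hmc).mono_set (Ioi_subset_Ioi hY.1)
  have hdisj : Disjoint (Ioc 0 Y) (Ioi Y) :=
    Set.disjoint_left.2 fun x hx hx' => absurd hx.2 (not_le.2 hx')
  unfold corrector
  rw [← Ioc_union_Ioi_eq_Ioi hY.1, setIntegral_union hdisj measurableSet_Ioi
    ((integrableOn_congr_fun hI1 measurableSet_Ioc).2 (hint1.const_mul _))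
    ((integrableOn_congr_fun hI2 measurableSet_Ioi).2 (hint2.const_mul _)),
    setIntegral_congr_fun measurableSet_Ioc hI1, setIntegral_congr_fun measurableSet_Ioi hI2,
    integral_const_mul, integral_const_mul, integral_Ioi_tail hU hm hmc hY.1,
    intervalIntegral.integral_of_le hY.1]
  ring

lemma corrector_zero (hU : IsBoundaryLayerProfile m U) (hm : 0 < m) (hc : 0 < c.im)
    (hmc : m * (1 + ‖c‖) < 1) :
    corrector m α U c 0 = -2 * (c * criticalIntegral U c) * tailIntegral m U c 0 := by
  rw [corrector_eq hU hm hc hmc ⟨le_rfl, zero_le_one⟩, phiMinus_zero hU]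
  simp
  ring

/-- The derivatives of the two integrals cancel, as usual for a Green's function continuous on the
diagonal. Only the derivatives of the exponential and of `φ₋` contribute, the first integral itself
being zero at `Y = 0`. -/
lemma corrector_hasDerivWithinAt_zero (hU : IsBoundaryLayerProfile m U) (hm : 0 < m)
    (hc : 0 < c.im) (hmc : m * (1 + ‖c‖) < 1) :
    HasDerivWithinAt (corrector m α U c)
      (2 * tailIntegral m U c 0 * (decayRate m α c * (c * criticalIntegral U c)
        + criticalIntegral U c + 1 / c - (m : ℂ) ^ 2 * c)) (Ici 0) 0 := by
  set β := decayRate m α c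
  have hc0 : c ≠ 0 := by rintro rfl; simp at hc
  have h1 : HasDerivWithinAt (fun Y : ℝ => (U Y : ℂ) - c) 1 (Ici 0) 0 := by
    have := ((hU.hasDerivWithinAt le_rfl).ofReal_comp.sub_const c)
    rwa [hU.deriv_zero, Complex.ofReal_one] at this
  have hexp : HasDerivWithinAt (fun Y : ℝ => -2 * Complex.exp (-β * (Y : ℂ))) (2 * β)
      (Ici 0) 0 := by
    have := (((hasDerivAt_id (0 : ℝ)).ofReal_comp.const_mul (-β)).cexp.const_mul
      (-2)).hasDerivWithinAt (s := Ici 0)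
    refine this.congr_deriv ?_
    simp
  have hcont : ContinuousOn (fun X => phiMinus m U c X * (coeffA m U c X ^ 2)⁻¹
        * (profileDeriv 1 U X : ℂ)) (Icc 0 1) := by
    have hUd := Complex.continuous_ofReal.comp_continuousOn hU.continuousOn_deriv
    exact ((continuousOn_phiMinus hU hc).mul
        ((((continuousOn_coeffA hU).mono Icc_subset_Ici_self).pow 2).inv₀
        (fun x hx => pow_ne_zero 2 (coeffA_ne_zero hU hm.le hmc hx.1)))).mul
        (hUd.mono Icc_subset_Ici_self)
  have h2 : HasDerivWithinAt (fun Y : ℝ => ∫ X in (0 : ℝ)..Y,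
      phiMinus m U c X * (coeffA m U c X ^ 2)⁻¹ * (profileDeriv 1 U X : ℂ))
      (phiMinus m U c 0 * (coeffA m U c 0 ^ 2)⁻¹ * (profileDeriv 1 U 0 : ℂ)) (Ici 0) 0 := by
    refine intervalIntegral.integral_hasDerivWithinAt_right (t := Ioi 0) (by simp) ?_ ?_
    · refine ⟨Ioc 0 1, Ioc_mem_nhdsGT one_pos, ?_⟩
      exact (hcont.mono Ioc_subset_Icc_self).aestronglyMeasurable measurableSet_Ioc
    · exact ((hcont 0 (left_mem_Icc.2 zero_le_one)).mono_of_mem_nhdsWithin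
        (Icc_mem_nhdsGE one_pos)).mono Ioi_subset_Ici_self
  have h3 := hexp.mul ((h1.mul h2).add ((phiMinus_hasDerivWithinAt_zero hU hc).mul
    (tailIntegral_hasDerivWithinAt hU hm hmc le_rfl)))
  refine (h3.congr_of_eventuallyEq
    (mem_of_superset (Icc_mem_nhdsGE one_pos) fun Y hY => corrector_eq hU hm hc hmc hY)
    (corrector_eq hU hm hc hmc ⟨le_rfl, zero_le_one⟩)).congr_deriv ?_
  simp only [Pi.mul_apply, Pi.add_apply, phiMinus_zero hU, hU.zero, hU.deriv_zero,
    intervalIntegral.integral_same, Complex.ofReal_zero, Complex.ofReal_one, mul_zero,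
    Complex.exp_zero]
  ring

end SlowMode

/-! ### Closed form and analyticity of the boundary function; the critical integral -/

section BoundaryFormula

variable {m α ε : ℝ} {U : ℝ → ℝ} {c : ℂ}

/-- The boundary value `Φ(0)` of the slow mode, in closed form. -/
def slowBoundaryValue (m α : ℝ) (U : ℝ → ℝ) (c : ℂ) : ℂ :=
  -c - 2 * decayRate m α c * (c * criticalIntegral U c) * tailIntegral m U c 0

/-- The boundary slope `Φ'(0)` of the slow mode, in closed form. -/
def slowBoundarySlope (m α : ℝ) (U : ℝ → ℝ) (c : ℂ) : ℂ :=
  1 + decayRate m α c * c + 2 * decayRate m α c * tailIntegral m U c 0 *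
    (decayRate m α c * (c * criticalIntegral U c) + (criticalIntegral U c + 1 / c)
      - (m : ℂ) ^ 2 * c)

lemma slowPhi_zero (hU : IsBoundaryLayerProfile m U) (hm : 0 < m) (hc : 0 < c.im)
    (hmc : m * (1 + ‖c‖) < 1) : slowPhi m α U c 0 = slowBoundaryValue m α U c := by
  unfold slowPhi phiPlusAlpha phiPlus slowBoundaryValue
  rw [corrector_zero hU hm hc hmc, hU.zero]
  simp
  ring

lemma slowPhiDeriv_zero (hU : IsBoundaryLayerProfile m U) (hm : 0 < m) (hc : 0 < c.im)
    (hmc : m * (1 + ‖c‖) < 1) : slowPhiDeriv m α U c 0 = slowBoundarySlope m α U c := by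
  set β := decayRate m α c with hβ
  have h1 : HasDerivWithinAt (fun Y : ℝ => (U Y : ℂ) - c) 1 (Ici 0) 0 := by
    have := ((hU.hasDerivWithinAt le_rfl).ofReal_comp.sub_const c)
    rwa [hU.deriv_zero, Complex.ofReal_one] at this
  have hexp : HasDerivWithinAt (fun Y : ℝ => Complex.exp (-β * (Y : ℂ))) (-β) (Ici 0) 0 := by
    have := ((hasDerivAt_id (0 : ℝ)).ofReal_comp.const_mul (-β)).cexp.hasDerivWithinAt
      (s := Ici 0)
    refine this.congr_deriv ?_
    simp
  have h := (hexp.mul h1).add ((corrector_hasDerivWithinAt_zero (α := α) hU hm hc hmc).const_mul β)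
  have h2 : HasDerivWithinAt (slowPhi m α U c) _ (Ici 0) 0 := h
  unfold slowPhiDeriv
  rw [h2.derivWithin (uniqueDiffOn_Ici 0 0 (mem_Ici.2 le_rfl)), hU.zero, slowBoundarySlope, ← hβ]
  simp
  ring

/-- The boundary function in terms of the boundary data of the slow mode. -/
lemma boundaryFn_eq (hU : IsBoundaryLayerProfile m U) (hm : 0 < m) (hc : 0 < c.im)
    (hmc : m * (1 + ‖c‖) < 1) (hα : α ≠ 0) (hδ : sublayerScale α ε ≠ 0)
    (hAi : airy 2 (airyPoint α ε c) ≠ 0) :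
    boundaryFn m α ε U c
      = (slowBoundarySlope m α U c + (m : ℂ) ^ 2 * c * slowBoundaryValue m α U c)
          / (1 - (m : ℂ) ^ 2 * c ^ 2)
        - (sublayerScale α ε)⁻¹ * slowBoundaryValue m α U c
          * (airy 1 (airyPoint α ε c) / airy 2 (airyPoint α ε c)) := by
  have hA : coeffA m U c 0 = 1 - (m : ℂ) ^ 2 * c ^ 2 := by
    unfold coeffA; rw [hU.zero]; simp
  have hA0 := coeffA_ne_zero hU hm.le hmc (le_refl (0 : ℝ))
  rw [hA] at hA0
  have hα' : (α : ℂ) ≠ 0 := by exact_mod_cast hα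
  unfold boundaryFn appU slowU slowRho slowV fastU fastV
  rw [slowPhi_zero hU hm hc hmc, slowPhiDeriv_zero hU hm hc hmc, hA, hU.zero, hU.deriv_zero]
  simp only [Complex.ofReal_zero, Complex.ofReal_one, mul_zero, zero_add, zero_sub, mul_one]
  have hI := Complex.I_ne_zero
  have hq : -Complex.I * α * slowBoundaryValue m α U c / (Complex.I * α * sublayerScale α ε)
      = -((sublayerScale α ε)⁻¹ * slowBoundaryValue m α U c) := by field_simp
  have hinv := mul_inv_cancel₀ hA0
  rw [div_self hAi, mul_one, hq, div_eq_mul_inv _ (1 - (m : ℂ) ^ 2 * c ^ 2), neg_div]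
  -- The slow tangential velocity at the wall is `Φ'(0) (1 + m²c²/A) + m² c Φ(0)/A` with `A = 1 -
  -- m²c²`, and `1 + m²c²/A = 1/A`.
  linear_combination (-slowBoundarySlope m α U c) * hinv

lemma criticalIntegral_differentiableAt (hU : IsBoundaryLayerProfile m U) (hc : 0 < c.im) :
    DifferentiableAt ℂ (criticalIntegral U) c := by
  -- As `U` is real, `|U - z| ≥ Im z`; this gives a constant dominating the differentiated
  -- integrand.
  have hball : ∀ z ∈ Metric.ball c (c.im / 2), c.im / 2 ≤ z.im := by
    intro z hz
    have h1 : |(z - c).im| ≤ ‖z - c‖ := Complex.abs_im_le_norm _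
    rw [Metric.mem_ball, dist_eq_norm] at hz
    rw [Complex.sub_im] at h1
    have := neg_abs_le (z.im - c.im)
    linarith
  have hmeas : ∀ {z : ℂ}, 0 < z.im → ContinuousOn (fun X => 2 / ((U X : ℂ) - z) ^ 3) (Icc 0 1) := by
    intro z hz
    have hsub : Icc (0 : ℝ) 1 ⊆ Ici 0 := Icc_subset_Ici_self
    have hUc := (Complex.continuous_ofReal.comp_continuousOn hU.continuousOn).mono hsub
    exact continuousOn_const.div ((hUc.sub continuousOn_const).pow 3)
      fun x _ => pow_ne_zero 3 (profile_sub_ne_zero hz _)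
  have h01 : uIoc (0 : ℝ) 1 ⊆ Icc 0 1 := by
    rw [uIoc_of_le zero_le_one]; exact Ioc_subset_Icc_self
  refine (intervalIntegral.hasDerivAt_integral_of_dominated_loc_of_deriv_le (𝕜 := ℂ)
    (F := fun z X => 1 / ((U X : ℂ) - z) ^ 2) (F' := fun z X => 2 / ((U X : ℂ) - z) ^ 3)
    (bound := fun _ => 2 / (c.im / 2) ^ 3)
    (Metric.ball_mem_nhds c (half_pos hc)) ?_ (intervalIntegrable_inv_sq hU hc) ?_ ?_
    (by simp) ?_).2.differentiableAt
  · filter_upwards [Metric.ball_mem_nhds c (half_pos hc)] with z hz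
    have hz0 : 0 < z.im := (half_pos hc).trans_le (hball z hz)
    exact ((continuousOn_inv_sq hU hz0).mono (h01.trans Icc_subset_Ici_self)).aestronglyMeasurable
      measurableSet_uIoc
  · exact ((hmeas hc).mono h01).aestronglyMeasurable measurableSet_uIoc
  · refine ae_of_all _ fun X _ z hz => ?_
    have h2 : c.im / 2 ≤ ‖(U X : ℂ) - z‖ := by
      have := Complex.abs_im_le_norm ((U X : ℂ) - z)
      simp only [Complex.sub_im, Complex.ofReal_im, zero_sub, abs_neg] at this
      exact ((hball z hz).trans (le_abs_self _)).trans this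
    have h3 := half_pos hc
    rw [norm_div, norm_pow, Complex.norm_ofNat]
    gcongr
  · refine ae_of_all _ fun X _ z hz => ?_
    have hz0 : 0 < z.im := (half_pos hc).trans_le (hball z hz)
    have hne := profile_sub_ne_zero hz0 (U X)
    have h1 := (((hasDerivAt_id z).const_sub (U X : ℂ)).pow 2).inv (pow_ne_zero 2 hne)
    simp only [one_div]
    refine h1.congr_deriv ?_
    simp
    field_simp

/-- The real part is positive because `|m² (1 - c)²| < 1`. This makes the principal root in `β`
holomorphic. -/
lemma coeffAInfty_mem_slitPlane (hm : 0 ≤ m) (hmc : m * (1 + ‖c‖) < 1) :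
    coeffAInfty m c ∈ Complex.slitPlane := by
  left
  have h1 : ‖(m : ℂ) ^ 2 * (1 - c) ^ 2‖ < 1 := by
    rw [← mul_pow, norm_pow, norm_mul, Complex.norm_real, Real.norm_of_nonneg hm]
    refine pow_lt_one₀ (by positivity) (lt_of_le_of_lt ?_ hmc) two_ne_zero
    gcongr
    refine (norm_sub_le _ _).trans ?_
    rw [norm_one]
  have h2 := Complex.re_le_norm ((m : ℂ) ^ 2 * (1 - c) ^ 2)
  unfold coeffAInfty
  rw [Complex.sub_re, Complex.one_re]
  linarith

lemma airy_differentiable (k : ℤ) : Differentiable ℂ (airy k) := fun z => by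
  have := airy_hasDerivAt (k - 1) z
  rw [sub_add_cancel] at this
  exact this.differentiableAt

/-- The domain on which the closed form of the boundary function is available. -/
def regularSet (m α ε : ℝ) : Set ℂ :=
  {c | 0 < c.im ∧ m * (1 + ‖c‖) < 1 ∧ airy 2 (airyPoint α ε c) ≠ 0}

lemma isOpen_regularSet (m α ε : ℝ) : IsOpen (regularSet m α ε) := by
  refine (isOpen_lt continuous_const Complex.continuous_im).inter
    ((isOpen_lt (f := fun c : ℂ => m * (1 + ‖c‖)) (by fun_prop) continuous_const).inter ?_)
  have h1 : Continuous (airyPoint α ε) := by unfold airyPoint; fun_prop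
  exact isOpen_ne_fun ((airy_differentiable 2).continuous.comp h1) continuous_const

/-- On the regular set the one-sided derivative and improper integral are replaced by the closed
form, in which `c` enters only through `β`, `S`, Airy primitives and rational functions. -/
lemma boundaryFn_differentiableOn (hU : IsBoundaryLayerProfile m U) (hm : 0 < m) (hα : α ≠ 0)
    (hδ : sublayerScale α ε ≠ 0) :
    DifferentiableOn ℂ (boundaryFn m α ε U) (regularSet m α ε) := by
  refine DifferentiableOn.congr ?_ fun c hc => boundaryFn_eq hU hm hc.1 hc.2.1 hα hδ hc.2.2
  intro c hc
  obtain ⟨hc1, hc2, hc3⟩ := hc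
  have hc0 : c ≠ 0 := by rintro rfl; simp at hc1
  refine DifferentiableAt.differentiableWithinAt ?_
  have hS := criticalIntegral_differentiableAt hU hc1
  have hA : coeffA m U c 0 ≠ 0 := coeffA_ne_zero hU hm.le hc2 le_rfl
  have hAf : (fun c => coeffA m U c 0) = fun c => 1 - (m : ℂ) ^ 2 * c ^ 2 := by
    funext c; unfold coeffA; rw [hU.zero]; simp
  have hA' : 1 - (m : ℂ) ^ 2 * c ^ 2 ≠ 0 := by rwa [← congrFun hAf c]
  have hAi := coeffAInfty_ne_zero hm.le hc2
  have hAis := coeffAInfty_mem_slitPlane hm.le hc2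
  have hdAi : DifferentiableAt ℂ (coeffAInfty m) c := by unfold coeffAInfty; fun_prop
  have hβ : DifferentiableAt ℂ (decayRate m α) c := by
    unfold decayRate
    exact (hdAi.cpow_const hAis).const_mul _
  have hT : DifferentiableAt ℂ (fun c => tailIntegral m U c 0) c := by
    unfold tailIntegral
    refine ((hdAi.fun_inv hAi).sub (DifferentiableAt.fun_inv ?_ hA)).div_const _
    rw [hAf]; fun_prop
  have hV : DifferentiableAt ℂ (slowBoundaryValue m α U) c := by
    unfold slowBoundaryValue; fun_prop
  have hD : DifferentiableAt ℂ (slowBoundarySlope m α U) c := by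
    unfold slowBoundarySlope; fun_prop (disch := assumption)
  have hz : DifferentiableAt ℂ (airyPoint α ε) c := by unfold airyPoint; fun_prop
  have h1 : DifferentiableAt ℂ (fun c => airy 1 (airyPoint α ε c)) c :=
    (airy_differentiable 1).differentiableAt.comp c hz
  have h2 : DifferentiableAt ℂ (fun c => airy 2 (airyPoint α ε c)) c :=
    (airy_differentiable 2).differentiableAt.comp c hz
  fun_prop (disch := assumption)

/-- `∫₀¹ dX / (U - c)²` equals `-1 / c` up to a logarithmic error. -/
lemma exists_criticalIntegral_bound (hU : IsBoundaryLayerProfile m U) {M y : ℝ} (hM : 0 ≤ M)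
    (hy : 0 < y) :
    ∃ B, ∀ η > 0, ∀ c : ℂ, ‖c‖ ≤ M * η → y * η ≤ c.im →
      ‖criticalIntegral U c + 1 / c‖ ≤ B * (1 + (Real.log (1 + η) - Real.log η)) := by
  obtain ⟨s, hs, hlow⟩ := hU.exists_linear_lower_bound
  obtain ⟨C, hC⟩ := hU.exists_deriv_lipschitz
  have hC0 : 0 ≤ C := by
    have := hC 1 (right_mem_Icc.2 zero_le_one)
    rw [mul_one] at this
    exact (abs_nonneg _).trans this
  -- Combines `|U - c| ≥ y η` with `|U - c| ≥ s X - M η` into a comparison of `|U - c|` with `X +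
  -- η`, uniform in `c`.
  set P := (1 + M / y) / s + 1 / y with hP
  have hP0 : 0 < P := by positivity
  refine ⟨P + C * P ^ 2, fun η hη c hcM hcy => ?_⟩
  have hc : 0 < c.im := (by positivity : 0 < y * η).trans_le hcy
  have hc0 : c ≠ 0 := by rintro rfl; simp at hc
  have hdist : ∀ X ∈ Icc (0 : ℝ) 1, X + η ≤ P * ‖(U X : ℂ) - c‖ := by
    intro X hX
    have h1 : y * η ≤ ‖(U X : ℂ) - c‖ := by
      have := Complex.abs_im_le_norm ((U X : ℂ) - c)
      simp only [Complex.sub_im, Complex.ofReal_im, zero_sub, abs_neg] at this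
      exact (hcy.trans (le_abs_self _)).trans this
    have h2 : s * X - M * η ≤ ‖(U X : ℂ) - c‖ := by
      have := norm_sub_norm_le (U X : ℂ) c
      rw [Complex.norm_real, Real.norm_of_nonneg (hU.nonneg hX.1)] at this
      linarith [hlow X hX]
    set d := ‖(U X : ℂ) - c‖
    have h3 : η ≤ d / y := by rw [le_div_iff₀ hy]; linarith
    have h4 : X ≤ (1 + M / y) / s * d := by
      rw [div_mul_eq_mul_div, le_div_iff₀ hs]
      have : M * η ≤ M * (d / y) := by gcongr
      have e : M * (d / y) = M / y * d := by ring
      nlinarith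
    have e : P * d = (1 + M / y) / s * d + d / y := by rw [hP]; ring
    linarith
  have hIcc : uIcc (0 : ℝ) 1 = Icc 0 1 := uIcc_of_le zero_le_one
  have hUd : ContinuousOn (fun X => (profileDeriv 1 U X : ℂ)) (Icc 0 1) :=
    (Complex.continuous_ofReal.comp_continuousOn hU.continuousOn_deriv).mono Icc_subset_Ici_self
  have hinv : ContinuousOn (fun X => 1 / ((U X : ℂ) - c) ^ 2) (Icc 0 1) :=
    (continuousOn_inv_sq hU hc).mono Icc_subset_Ici_self
  have hi1 : IntervalIntegrable (fun X => (profileDeriv 1 U X : ℂ) * (1 / ((U X : ℂ) - c) ^ 2))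
      volume 0 1 := (hUd.mul hinv).intervalIntegrable_of_Icc zero_le_one
  have hftc : ∫ X in (0 : ℝ)..1, (profileDeriv 1 U X : ℂ) * (1 / ((U X : ℂ) - c) ^ 2)
      = -((U 1 : ℂ) - c)⁻¹ - 1 / c := by
    have hd : ∀ {X : ℝ}, 0 ≤ X → HasDerivWithinAt (fun X => -((U X : ℂ) - c)⁻¹)
        ((profileDeriv 1 U X : ℂ) * (1 / ((U X : ℂ) - c) ^ 2)) (Ici 0) X := by
      intro X hX
      have h := (((hU.hasDerivWithinAt hX).ofReal_comp.sub_const c).inv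
        (profile_sub_ne_zero hc _)).neg
      refine h.congr_deriv ?_
      ring
    have := intervalIntegral.integral_eq_sub_of_hasDerivAt_of_le zero_le_one
      (f := fun X => -((U X : ℂ) - c)⁻¹)
      (fun X hX => (hd hX.1).continuousWithinAt.mono Icc_subset_Ici_self)
      (fun X hX => (hd hX.1.le).hasDerivAt (Ici_mem_nhds hX.1)) hi1
    rw [this, hU.zero]
    simp
  -- Write `1 = U' + (1 - U')`: the first part integrates exactly and carries the pole `-1/c`.
  have hsplit : criticalIntegral U c + 1 / c = -((U 1 : ℂ) - c)⁻¹ +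
      ∫ X in (0 : ℝ)..1, (1 - (profileDeriv 1 U X : ℂ)) * (1 / ((U X : ℂ) - c) ^ 2) := by
    have : ∫ X in (0 : ℝ)..1, (1 - (profileDeriv 1 U X : ℂ)) * (1 / ((U X : ℂ) - c) ^ 2)
        = criticalIntegral U c - (-((U 1 : ℂ) - c)⁻¹ - 1 / c) := by
      rw [← hftc, criticalIntegral, ← intervalIntegral.integral_sub
        (intervalIntegrable_inv_sq hU hc) hi1]
      congr 1; funext X; ring
    rw [this]; ring
  have hlog : ∫ X in (0 : ℝ)..1, (X + η)⁻¹ = Real.log (1 + η) - Real.log η := by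
    rw [intervalIntegral.integral_comp_add_right (fun x => x⁻¹) η, zero_add,
      integral_inv_of_pos hη (by linarith), Real.log_div (by linarith) hη.ne']
  have hbound : ‖∫ X in (0 : ℝ)..1, (1 - (profileDeriv 1 U X : ℂ)) * (1 / ((U X : ℂ) - c) ^ 2)‖
      ≤ ∫ X in (0 : ℝ)..1, C * P ^ 2 * (X + η)⁻¹ := by
    refine intervalIntegral.norm_integral_le_of_norm_le zero_le_one
      (ae_of_all _ fun X hX => ?_) ?_
    · have hX' : X ∈ Icc (0 : ℝ) 1 := Ioc_subset_Icc_self hX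
      have h1 := hC X hX'
      have h2 := hdist X hX'
      have hXη : 0 < X + η := by linarith [hX.1]
      have hd0 : 0 < ‖(U X : ℂ) - c‖ := norm_pos_iff.2 (profile_sub_ne_zero hc _)
      have e1 : ‖1 - (profileDeriv 1 U X : ℂ)‖ = |1 - profileDeriv 1 U X| := by
        rw [← Complex.ofReal_one, ← Complex.ofReal_sub, Complex.norm_real, Real.norm_eq_abs]
      rw [norm_mul, e1, norm_div, norm_pow, norm_one]
      have h3 : 1 / ‖(U X : ℂ) - c‖ ^ 2 ≤ P ^ 2 * ((X + η)⁻¹) ^ 2 := by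
        rw [div_le_iff₀ (by positivity), inv_pow]
        have : (X + η) ^ 2 ≤ (P * ‖(U X : ℂ) - c‖) ^ 2 := by gcongr
        have e : P ^ 2 * ((X + η) ^ 2)⁻¹ * ‖(U X : ℂ) - c‖ ^ 2
          = (P * ‖(U X : ℂ) - c‖) ^ 2 / (X + η) ^ 2 := by ring
        rwa [e, le_div_iff₀ (by positivity), one_mul]
      -- The factor `|1 - U'| ≤ C X` cancels one power of `X + η`, which leaves a logarithm after
      -- integration.
      calc |1 - profileDeriv 1 U X| * (1 / ‖(U X : ℂ) - c‖ ^ 2)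
          ≤ (C * (X + η)) * (P ^ 2 * ((X + η)⁻¹) ^ 2) := by
            refine mul_le_mul (h1.trans ?_) h3 (by positivity) (by positivity)
            gcongr; linarith
        _ = C * P ^ 2 * (X + η)⁻¹ := by field_simp
    · refine ContinuousOn.intervalIntegrable ?_
      rw [hIcc]
      exact continuousOn_const.mul ((by fun_prop : ContinuousOn (fun X : ℝ => X + η) _).inv₀
        fun X hX => by linarith [hX.1])
  rw [intervalIntegral.integral_const_mul, hlog] at hbound
  have hL : 0 ≤ Real.log (1 + η) - Real.log η := by
    have := Real.log_le_log hη (by linarith : η ≤ 1 + η)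
    linarith
  have hone : ‖-((U 1 : ℂ) - c)⁻¹‖ ≤ P := by
    have h1 := hdist 1 (right_mem_Icc.2 zero_le_one)
    have hd0 : 0 < ‖(U 1 : ℂ) - c‖ := norm_pos_iff.2 (profile_sub_ne_zero hc _)
    rw [norm_neg, norm_inv, inv_le_iff_one_le_mul₀ hd0]
    linarith
  rw [hsplit]
  refine (norm_add_le _ _).trans ((add_le_add hone hbound).trans ?_)
  have : 0 ≤ P * (Real.log (1 + η) - Real.log η) := by positivity
  have : 0 ≤ C * P ^ 2 := by positivity
  nlinarith

end BoundaryFormula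

/-! ### The limit of vanishing viscosity at fixed `K`, uniformly in the scaled wave speed -/

section SmallViscosity

variable {m K M y : ℝ} {U : ℝ → ℝ} {D : Set ℂ}

/-- The logarithmic error is beaten by the prefactor, since `η log η → 0`. The product filter with
`𝓟 D` expresses uniformity in `ζ ∈ D`. -/
lemma tendsto_mul_criticalIntegral (hU : IsBoundaryLayerProfile m U) (hM : 0 ≤ M) (hy : 0 < y)
    (hD : ∀ ζ ∈ D, ‖ζ‖ ≤ M ∧ y ≤ ζ.im) :
    Tendsto (fun p : ℝ × ℂ => (p.1 : ℂ) *
      (criticalIntegral U (p.1 * p.2) + 1 / ((p.1 : ℂ) * p.2))) (𝓝[>] 0 ×ˢ 𝓟 D) (𝓝 0) := by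
  obtain ⟨B, hB⟩ := exists_criticalIntegral_bound hU hM hy
  have hg : Tendsto (fun η : ℝ => B * (η + (η * Real.log (1 + η) - η * Real.log η)))
      (𝓝[>] 0) (𝓝 0) := by
    have h1 : ContinuousAt (fun η : ℝ => B * (η + (η * Real.log (1 + η) - η * Real.log η))) 0 := by
      have := Real.continuous_mul_log.continuousAt (x := (0 : ℝ))
      have h2 : ContinuousAt (fun η : ℝ => Real.log (1 + η)) 0 :=
        ContinuousAt.log (by fun_prop) (by norm_num)
      fun_prop
    have h2 := h1.tendsto
    simp only [zero_mul, sub_zero, add_zero, mul_zero] at h2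
    exact h2.mono_left nhdsWithin_le_nhds
  refine squeeze_zero_norm' ?_ (hg.comp tendsto_fst)
  filter_upwards [tendsto_fst (self_mem_nhdsWithin : Ioi (0 : ℝ) ∈ 𝓝[>] 0),
    tendsto_snd (mem_principal_self D)] with p hp1 hp2
  have hη : 0 < p.1 := hp1
  obtain ⟨hζM, hζy⟩ := hD p.2 hp2
  have h := hB p.1 hη (p.1 * p.2) (by
      rw [norm_mul, Complex.norm_real, Real.norm_of_nonneg hη.le, mul_comm M]
      gcongr)
    (by rw [Complex.im_ofReal_mul, mul_comm]; gcongr)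
  rw [norm_mul, Complex.norm_real, Real.norm_of_nonneg hη.le]
  calc _ ≤ p.1 * (B * (1 + (Real.log (1 + p.1) - Real.log p.1))) := by gcongr
    _ = _ := by simp only [Function.comp]; ring

lemma tendsto_scaled_zero (hD : ∀ ζ ∈ D, ‖ζ‖ ≤ M) :
    Tendsto (fun p : ℝ × ℂ => (p.1 : ℂ) * p.2) (𝓝[>] 0 ×ˢ 𝓟 D) (𝓝 0) := by
  have hg : Tendsto (fun η : ℝ => |η| * M) (𝓝[>] 0) (𝓝 0) := by
    have : Continuous fun η : ℝ => |η| * M := by fun_prop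
    have h := this.tendsto 0
    simp only [abs_zero, zero_mul] at h
    exact h.mono_left nhdsWithin_le_nhds
  refine squeeze_zero_norm' ?_ (hg.comp tendsto_fst)
  filter_upwards [tendsto_snd (mem_principal_self D)] with p hp2
  rw [norm_mul, Complex.norm_real, Real.norm_eq_abs]
  exact mul_le_mul_of_nonneg_left (hD _ hp2) (abs_nonneg _)

lemma tendsto_sqrt_coeffAInfty {ι : Type*} {l : Filter ι} {c : ι → ℂ} (hm : m ∈ Ioo (0 : ℝ) 1)
    (hc : Tendsto c l (𝓝 0)) :
    Tendsto (fun i => coeffAInfty m (c i) ^ (1 / 2 : ℂ)) l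
      (𝓝 (((1 - m ^ 2) ^ (1 / 2 : ℝ) : ℝ) : ℂ)) := by
  have hpos : 0 < 1 - m ^ 2 := by nlinarith [hm.1, hm.2]
  rw [Complex.ofReal_cpow hpos.le]
  have h1 : ContinuousAt (fun c => coeffAInfty m c ^ (1 / 2 : ℂ)) 0 := by
    refine (DifferentiableAt.cpow_const (by unfold coeffAInfty; fun_prop) ?_).continuousAt
    exact coeffAInfty_mem_slitPlane hm.1.le (by simpa using hm.2)
  have h2 := h1.tendsto.comp hc
  have e : coeffAInfty m 0 = ((1 - m ^ 2 : ℝ) : ℂ) := by unfold coeffAInfty; push_cast; ring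
  rw [e] at h2
  have e2 : ((1 / 2 : ℝ) : ℂ) = 1 / 2 := by push_cast; rfl
  rw [e2]
  exact h2

/-- At `c = 0` one has `A_∞ = 1 - m²` and `A(0) = 1`, so the numerator contains a factor `m²` that
cancels the denominator's. -/
lemma tendsto_tailIntegral {ι : Type*} {l : Filter ι} {c : ι → ℂ} (hm : m ∈ Ioo (0 : ℝ) 1)
    (hU : IsBoundaryLayerProfile m U) (hc : Tendsto c l (𝓝 0)) :
    Tendsto (fun i => tailIntegral m U (c i) 0) l (𝓝 (1 / (2 * (1 - (m : ℂ) ^ 2)))) := by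
  have hmc : m * (1 + ‖(0 : ℂ)‖) < 1 := by simpa using hm.2
  have h0 : coeffAInfty m 0 ≠ 0 := coeffAInfty_ne_zero hm.1.le hmc
  have h1 : ContinuousAt (fun c => tailIntegral m U c 0) 0 := by
    have hA : coeffA m U 0 0 ≠ 0 := coeffA_ne_zero hU hm.1.le hmc le_rfl
    unfold tailIntegral
    exact ((ContinuousAt.inv₀ (by unfold coeffAInfty; fun_prop) h0).sub
      (ContinuousAt.inv₀ (by unfold coeffA; fun_prop) hA)).div_const _
  have h2 := h1.tendsto.comp hc
  have e : tailIntegral m U 0 0 = 1 / (2 * (1 - (m : ℂ) ^ 2)) := by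
    have hm0 : (m : ℂ) ≠ 0 := by exact_mod_cast hm.1.ne'
    have h3 : 1 - (m : ℂ) ^ 2 ≠ 0 := by simpa [coeffAInfty] using h0
    unfold tailIntegral coeffAInfty coeffA
    rw [hU.zero]
    simp
    field_simp
    ring
  rw [e] at h2
  exact h2

/-- Since `c S → -1`, the corrector contributes to `Φ(0)` at the same order `η` as `-c`, which is
the origin of the leading wave speed `K / (1 - m²)^{1/2}`. In the slope, `β S` and `β / c` are each
of order one, but they occur only in the sum `β (S + 1/c)`, which vanishes in the limit. -/
lemma tendsto_slowBoundary (hm : m ∈ Ioo (0 : ℝ) 1) (hU : IsBoundaryLayerProfile m U)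
    (hM : 0 ≤ M) (hy : 0 < y) (hD : ∀ ζ ∈ D, ‖ζ‖ ≤ M ∧ y ≤ ζ.im) :
    Tendsto (fun p : ℝ × ℂ => slowBoundaryValue m (K * p.1) U (p.1 * p.2) / p.1 + p.2)
        (𝓝[>] 0 ×ˢ 𝓟 D) (𝓝 ((K / (1 - m ^ 2) ^ (1 / 2 : ℝ) : ℝ) : ℂ)) ∧
      Tendsto (fun p : ℝ × ℂ => slowBoundaryValue m (K * p.1) U (p.1 * p.2))
        (𝓝[>] 0 ×ˢ 𝓟 D) (𝓝 0) ∧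
      Tendsto (fun p : ℝ × ℂ => slowBoundarySlope m (K * p.1) U (p.1 * p.2))
        (𝓝[>] 0 ×ˢ 𝓟 D) (𝓝 1) := by
  set l : Filter (ℝ × ℂ) := 𝓝[>] 0 ×ˢ 𝓟 D with hl
  have hpos : 0 < 1 - m ^ 2 := by nlinarith [hm.1, hm.2]
  set μ : ℝ := (1 - m ^ 2) ^ (1 / 2 : ℝ) with hμ
  have hμ0 : 0 < μ := Real.rpow_pos_of_pos hpos _
  have hμ2 : μ * μ = 1 - m ^ 2 := by
    rw [hμ, ← Real.rpow_add hpos]; norm_num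
  have hη : Tendsto (fun p : ℝ × ℂ => (p.1 : ℂ)) l (𝓝 0) := by
    have h1 : Tendsto (fun p : ℝ × ℂ => p.1) l (𝓝 0) :=
      tendsto_fst.mono_right nhdsWithin_le_nhds
    exact (Complex.continuous_ofReal.tendsto 0).comp h1
  have hc := tendsto_scaled_zero fun ζ hζ => (hD ζ hζ).1
  rw [← hl] at hc
  have hσ := tendsto_mul_criticalIntegral hU hM hy hD
  rw [← hl] at hσ
  have hA := tendsto_sqrt_coeffAInfty hm hc
  rw [← hμ] at hA
  have hT := tendsto_tailIntegral hm hU hc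
  have hmem : ∀ᶠ p in l, 0 < p.1 ∧ p.2 ∈ D :=
    (tendsto_fst.eventually (self_mem_nhdsWithin : Ioi (0 : ℝ) ∈ 𝓝[>] 0)).and
      (tendsto_snd.eventually (mem_principal_self D))
  have hne : ∀ p : ℝ × ℂ, 0 < p.1 ∧ p.2 ∈ D → (p.1 : ℂ) ≠ 0 ∧ p.2 ≠ 0 := by
    intro p hp
    refine ⟨by exact_mod_cast hp.1.ne', ?_⟩
    intro h
    have := (hD _ hp.2).2
    rw [h] at this
    simp at this
    linarith
  have hcS : Tendsto (fun p : ℝ × ℂ => (p.1 * p.2) * criticalIntegral U (p.1 * p.2)) l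
      (𝓝 (-1)) := by
    have h1 : Tendsto (fun p : ℝ × ℂ => p.2 * ((p.1 : ℂ) *
        (criticalIntegral U (p.1 * p.2) + 1 / ((p.1 : ℂ) * p.2)))) l (𝓝 0) := by
      have h2 := (tendsto_norm_zero.comp hσ).mul_const M
      rw [zero_mul] at h2
      refine squeeze_zero_norm' ?_ h2
      filter_upwards [hmem] with p hp
      rw [norm_mul, mul_comm]
      exact mul_le_mul_of_nonneg_left (hD _ hp.2).1 (norm_nonneg _)
    have h3 := h1.sub_const 1
    rw [zero_sub] at h3
    refine h3.congr' ?_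
    filter_upwards [hmem] with p hp
    obtain ⟨h4, h5⟩ := hne p hp
    field_simp
    ring
  have hβ : Tendsto (fun p : ℝ × ℂ => decayRate m (K * p.1) (p.1 * p.2)) l (𝓝 0) := by
    have h1 := ((hη.const_mul (K : ℂ)).mul hA)
    rw [mul_zero, zero_mul] at h1
    refine h1.congr fun p => ?_
    unfold decayRate; push_cast; rfl
  have hβS : Tendsto (fun p : ℝ × ℂ => decayRate m (K * p.1) (p.1 * p.2) *
      (criticalIntegral U (p.1 * p.2) + 1 / ((p.1 : ℂ) * p.2))) l (𝓝 0) := by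
    have h1 := (hA.const_mul (K : ℂ)).mul hσ
    rw [mul_zero] at h1
    refine h1.congr fun p => ?_
    unfold decayRate; push_cast; ring
  have hV : Tendsto (fun p : ℝ × ℂ => slowBoundaryValue m (K * p.1) U (p.1 * p.2)) l (𝓝 0) := by
    have h1 := hc.neg.sub (((hβ.const_mul 2).mul hcS).mul hT)
    simp only [mul_zero, zero_mul, neg_zero, sub_zero] at h1
    exact h1
  refine ⟨?_, hV, ?_⟩
  · have h1 := (((hA.const_mul (-2 * (K : ℂ))).mul hcS).mul hT)
    have e : -2 * (K : ℂ) * μ * -1 * (1 / (2 * (1 - (m : ℂ) ^ 2))) = ((K / μ : ℝ) : ℂ) := by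
      have e1 : 1 - (m : ℂ) ^ 2 = (μ : ℂ) * μ := by
        rw [← Complex.ofReal_mul, hμ2]; push_cast; rfl
      have e2 : (μ : ℂ) ≠ 0 := by exact_mod_cast hμ0.ne'
      rw [e1]; push_cast
      field_simp
    rw [e] at h1
    refine h1.congr' ?_
    filter_upwards [hmem] with p hp
    obtain ⟨h4, h5⟩ := hne p hp
    unfold slowBoundaryValue decayRate
    push_cast
    field_simp
    ring
  · have h1 := ((hβ.mul hc).const_add 1).add ((hT.const_mul 2).mul
      (((hβ.mul (hβ.mul hcS)).add hβS).sub ((hβ.mul hc).const_mul ((m : ℂ) ^ 2))))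
    simp only [mul_zero, zero_mul, add_zero, sub_zero] at h1
    refine h1.congr fun p => ?_
    unfold slowBoundarySlope
    ring

/-- Here `n = K ε^{1/8 - 1/2} = K ε^{-3/8}`, so `n^{-1/3}` has the same scale `ε^{1/8}` as the wave
speed. -/
lemma sublayerScale_waveNumber (hK : 0 < K) {ε : ℝ} (hε : 0 < ε) :
    sublayerScale (waveNumber K ε) ε
      = (Complex.exp (Real.pi * Complex.I / 6))⁻¹ * ((K ^ (1 / 3 : ℝ) : ℝ) : ℂ)⁻¹
        * ((ε ^ (1 / 8 : ℝ) : ℝ) : ℂ) := by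
  have h1 : (waveNumber K ε / √ε) ^ (-(1 / 3) : ℝ) = (K ^ (1 / 3 : ℝ))⁻¹ * ε ^ (1 / 8 : ℝ) := by
    unfold waveNumber
    rw [Real.sqrt_eq_rpow, mul_div_assoc, ← Real.rpow_sub hε, Real.mul_rpow hK.le (by positivity),
      ← Real.rpow_mul hε.le, Real.rpow_neg hK.le]
    norm_num
  unfold sublayerScale
  rw [h1, ← Complex.exp_neg]
  push_cast
  rw [mul_assoc]
  congr 2
  ring

/-- The argument of the Airy functions at the wave speed `c = ε^{1/8} ζ`. -/
def scaledAiryPoint (K : ℝ) (ζ : ℂ) : ℂ :=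
  -(Complex.exp (Real.pi * Complex.I / 6) * ((K ^ (1 / 3 : ℝ) : ℝ) : ℂ)) * ζ

lemma airyPoint_waveNumber (hK : 0 < K) {ε : ℝ} (hε : 0 < ε) (ζ : ℂ) :
    airyPoint (waveNumber K ε) ε (((ε ^ (1 / 8 : ℝ) : ℝ) : ℂ) * ζ) = scaledAiryPoint K ζ := by
  have h1 : ((ε ^ (1 / 8 : ℝ) : ℝ) : ℂ) ≠ 0 := by
    exact_mod_cast (Real.rpow_pos_of_pos hε _).ne'
  unfold airyPoint scaledAiryPoint
  rw [sublayerScale_waveNumber hK hε, mul_inv, mul_inv, inv_inv, inv_inv]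
  field_simp

/-- The limit of the boundary function as `ε → 0` at the wave speed `c = ε^{1/8} ζ`. -/
def limitFn (m K : ℝ) (ζ : ℂ) : ℂ :=
  1 - Complex.exp (Real.pi * Complex.I / 6) * ((K ^ (1 / 3 : ℝ) : ℝ) : ℂ)
    * (((K / (1 - m ^ 2) ^ (1 / 2 : ℝ) : ℝ) : ℂ) - ζ)
    * (airy 1 (scaledAiryPoint K ζ) / airy 2 (scaledAiryPoint K ζ))

/-- The Airy quotient is a fixed function of `ζ`, bounded by `Q`. It therefore suffices that the
slow boundary data converge uniformly on `D`. -/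
theorem boundaryFn_limit (hm : m ∈ Ioo (0 : ℝ) 1) (hU : IsBoundaryLayerProfile m U) (hK : 0 < K)
    (hM : 0 ≤ M) (hy : 0 < y) (hD : ∀ ζ ∈ D, ‖ζ‖ ≤ M ∧ y ≤ ζ.im) {Q : ℝ}
    (hAi : ∀ ζ ∈ D, airy 2 (scaledAiryPoint K ζ) ≠ 0 ∧
      ‖airy 1 (scaledAiryPoint K ζ) / airy 2 (scaledAiryPoint K ζ)‖ ≤ Q)
    {τ : ℝ} (hτ : 0 < τ) :
    ∀ᶠ ε in 𝓝[>] (0 : ℝ), ∀ ζ ∈ D,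
      ((ε ^ (1 / 8 : ℝ) : ℝ) : ℂ) * ζ ∈ regularSet m (waveNumber K ε) ε ∧
      ‖boundaryFn m (waveNumber K ε) ε U (((ε ^ (1 / 8 : ℝ) : ℝ) : ℂ) * ζ) - limitFn m K ζ‖ ≤ τ := by
  obtain ⟨h1, h2, h3⟩ := tendsto_slowBoundary (K := K) hm hU hM hy hD
  have hc := tendsto_scaled_zero fun ζ hζ => (hD ζ hζ).1
  set E : ℂ := Complex.exp (Real.pi * Complex.I / 6) * ((K ^ (1 / 3 : ℝ) : ℝ) : ℂ) with hE
  have hG : Tendsto (fun p : ℝ × ℂ => (slowBoundarySlope m (K * p.1) U (p.1 * p.2)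
      + (m : ℂ) ^ 2 * (p.1 * p.2) * slowBoundaryValue m (K * p.1) U (p.1 * p.2))
      / (1 - (m : ℂ) ^ 2 * (p.1 * p.2) ^ 2) - 1) (𝓝[>] 0 ×ˢ 𝓟 D) (𝓝 0) := by
    have h4 := ((h3.add ((hc.const_mul ((m : ℂ) ^ 2)).mul h2)).div
      (((hc.pow 2).const_mul ((m : ℂ) ^ 2)).const_sub 1) (by simp)).sub_const 1
    simpa using h4
  have hR : Tendsto (fun p : ℝ × ℂ => (slowBoundaryValue m (K * p.1) U (p.1 * p.2) / p.1 + p.2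
      - ((K / (1 - m ^ 2) ^ (1 / 2 : ℝ) : ℝ) : ℂ))
      * (airy 1 (scaledAiryPoint K p.2) / airy 2 (scaledAiryPoint K p.2)))
      (𝓝[>] 0 ×ˢ 𝓟 D) (𝓝 0) := by
    have h5 := h1.sub_const (((K / (1 - m ^ 2) ^ (1 / 2 : ℝ) : ℝ) : ℂ))
    rw [sub_self] at h5
    have h6 := (tendsto_norm_zero.comp h5).mul_const Q
    rw [zero_mul] at h6
    refine squeeze_zero_norm' ?_ h6
    filter_upwards [tendsto_snd (mem_principal_self D)] with p hp
    rw [norm_mul]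
    exact mul_le_mul_of_nonneg_left (hAi _ hp).2 (norm_nonneg _)
  -- With `δ⁻¹ = E / η`, this combination is exactly the boundary function minus its limit.
  have hF := hG.sub (hR.const_mul E)
  rw [mul_zero, sub_zero] at hF
  have hev1 := (tendsto_norm_zero.comp hF).eventually (ge_mem_nhds hτ)
  have hev2 : ∀ᶠ p : ℝ × ℂ in 𝓝[>] 0 ×ˢ 𝓟 D, m * (1 + ‖(p.1 : ℂ) * p.2‖) < 1 := by
    have h7 := ((tendsto_norm_zero.comp hc).const_add 1).const_mul m
    rw [add_zero, mul_one] at h7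
    exact h7.eventually (gt_mem_nhds hm.2)
  have hev := hev1.and hev2
  rw [eventually_prod_principal_iff] at hev
  have hroot : Tendsto (fun ε : ℝ => ε ^ (1 / 8 : ℝ)) (𝓝[>] 0) (𝓝[>] 0) := by
    refine tendsto_nhdsWithin_iff.2 ⟨?_, ?_⟩
    · have : ContinuousAt (fun ε : ℝ => ε ^ (1 / 8 : ℝ)) 0 :=
        Real.continuousAt_rpow_const _ _ (Or.inr (by norm_num))
      have h8 := this.tendsto
      rw [Real.zero_rpow (by norm_num)] at h8
      exact h8.mono_left nhdsWithin_le_nhds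
    · filter_upwards [self_mem_nhdsWithin] with ε hε
      exact Real.rpow_pos_of_pos hε _
  filter_upwards [hroot.eventually hev, self_mem_nhdsWithin] with ε hεev hε ζ hζ
  have hε0 : 0 < ε := hε
  obtain ⟨e1, e2⟩ := hεev ζ hζ
  simp only [Function.comp] at e1 e2
  set η : ℝ := ε ^ (1 / 8 : ℝ) with hη
  have hη0 : 0 < η := Real.rpow_pos_of_pos hε0 _
  have hηc : (η : ℂ) ≠ 0 := by exact_mod_cast hη0.ne'
  have hE0 : E ≠ 0 := by
    have : ((K ^ (1 / 3 : ℝ) : ℝ) : ℂ) ≠ 0 := by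
      exact_mod_cast (Real.rpow_pos_of_pos hK _).ne'
    exact mul_ne_zero (Complex.exp_ne_zero _) this
  have hpt := airyPoint_waveNumber hK hε0 ζ
  rw [← hη] at hpt
  have hscale : sublayerScale (waveNumber K ε) ε = E⁻¹ * η := by
    rw [sublayerScale_waveNumber hK hε0, hE, mul_inv]
  have him : 0 < ((η : ℂ) * ζ).im := by
    have := (hD ζ hζ).2
    simp
    nlinarith
  have hAi' : airy 2 (airyPoint (waveNumber K ε) ε (η * ζ)) ≠ 0 := by
    rw [hpt]; exact (hAi ζ hζ).1
  refine ⟨⟨him, e2, hAi'⟩, ?_⟩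
  rw [boundaryFn_eq (α := waveNumber K ε) hU hm.1 him e2 (mul_pos hK hη0).ne'
    (by rw [hscale]; exact mul_ne_zero (inv_ne_zero hE0) hηc) hAi', hpt, hscale]
  have hw : waveNumber K ε = K * η := rfl
  rw [hw]
  refine le_trans (le_of_eq ?_) e1
  congr 1
  unfold limitFn
  rw [← hE, mul_inv, inv_inv]
  ring

end SmallViscosity

/-! ### The limiting dispersion relation for large `K` -/

lemma exists_sq_eq_near_one (x : ℂ) : ∃ q : ℂ, q ^ 2 = x ∧ ‖q - 1‖ ≤ ‖x - 1‖ := by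
  -- The root with `Re q ≥ 0` satisfies `|q + 1| ≥ 1`, and `x - 1 = (q - 1)(q + 1)`.
  obtain ⟨q, hq, hre⟩ : ∃ q : ℂ, q ^ 2 = x ∧ 0 ≤ q.re := by
    obtain ⟨q, hq⟩ := IsAlgClosed.exists_pow_nat_eq x two_pos
    rcases le_total 0 q.re with h | h
    · exact ⟨q, hq, h⟩
    · exact ⟨-q, by rw [neg_sq, hq], by simpa using h⟩
  refine ⟨q, hq, ?_⟩
  have h1 : 1 ≤ ‖q + 1‖ := by
    have := Complex.re_le_norm (q + 1)
    simp at this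
    linarith
  have h2 : x - 1 = (q - 1) * (q + 1) := by rw [← hq]; ring
  rw [h2, norm_mul]
  exact le_mul_of_one_le_right (norm_nonneg _) h1

lemma norm_exp_real_mul_I (a : ℝ) : ‖Complex.exp (a * Complex.I)‖ = 1 :=
  Complex.norm_exp_ofReal_mul_I a

/-- For large `K` the limiting boundary function is a small perturbation of an affine function near
the leading order wave speed. -/
theorem limit_dispersion :
    ∃ C > 0, ∃ K₁ ≥ (1 : ℝ), ∀ ν ∈ Ioc (0 : ℝ) 1, ∀ K ≥ K₁, ∀ ζ : ℂ,
      ‖((K / ν : ℝ) : ℂ) * (((K / ν ^ 2 : ℝ) : ℂ) - ζ)‖ ≤ 4 →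
      airy 2 (scaledAiryPoint K ζ) ≠ 0 ∧
      ‖airy 1 (scaledAiryPoint K ζ) / airy 2 (scaledAiryPoint K ζ)‖ ≤ 4 * (K ^ (2 / 3 : ℝ) / ν) ∧
      ‖-(Complex.exp (Real.pi * Complex.I / 6) * ((K ^ (1 / 3 : ℝ) : ℝ) : ℂ)
          * (((K / ν ^ 2 : ℝ) : ℂ) - ζ)
          * (airy 1 (scaledAiryPoint K ζ) / airy 2 (scaledAiryPoint K ζ)))
        - Complex.exp (-(Real.pi * Complex.I / 4)) *
          (((K / ν : ℝ) : ℂ) * (((K / ν ^ 2 : ℝ) : ℂ) - ζ))‖ ≤ C / K := by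
  -- Since `-e^{iπ/6} = e^{-5πi/6}`, the saddle points in direction `e^{-5πi/12}`, whose real part
  -- is `a > 0`.
  set a : ℝ := Real.cos (5 * Real.pi / 12) with ha
  have ha0 : 0 < a := Real.cos_pos_of_mem_Ioo ⟨by linarith [Real.pi_pos], by linarith [Real.pi_pos]⟩
  have ha1 : a ≤ 1 := Real.cos_le_one _
  obtain ⟨C, hC, R, hR, hairy⟩ := airy_quotient_asymptotics (κ := a / 4) (by positivity)
  -- The thresholds ensure, in order, `4/K ≤ a/2` (the saddle stays in the sector of constant
  -- `a/4`), `‖t‖ ≥ R`, and `‖ρ‖ ≤ 1`. The constant is the bound `4` on `‖d‖` times the relative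
  -- error `(8 + 4C)/K`.
  refine ⟨4 * (8 + 4 * C), by positivity,
    max (8 / a) (max ((2 * R) ^ (3 / 2 : ℝ)) (4 * C)), ?_, fun ν hν K hK ζ hζ => ?_⟩
  · refine le_max_of_le_left ?_
    rw [le_div_iff₀ ha0]; linarith
  have hKa : 8 / a ≤ K := (le_max_left _ _).trans hK
  have hKR : (2 * R) ^ (3 / 2 : ℝ) ≤ K := ((le_max_left _ _).trans (le_max_right _ _)).trans hK
  have hKC : 4 * C ≤ K := ((le_max_right _ _).trans (le_max_right _ _)).trans hK
  have hK8 : 8 ≤ K * a := by rwa [div_le_iff₀ ha0] at hKa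
  have hK1 : 8 ≤ K := by nlinarith
  have hK0 : 0 < K := by linarith
  have hν0 : 0 < ν := hν.1
  have hνc : (ν : ℂ) ≠ 0 := by exact_mod_cast hν0.ne'
  have hKc : (K : ℂ) ≠ 0 := by exact_mod_cast hK0.ne'
  obtain ⟨q, hq, hq1⟩ := exists_sq_eq_near_one (ζ / ((K / ν ^ 2 : ℝ) : ℂ))
  set d : ℂ := ((K / ν : ℝ) : ℂ) * (((K / ν ^ 2 : ℝ) : ℂ) - ζ) with hd
  -- The relative distance of `ζ` from `K/ν²` is `ν³ ‖d‖ / K²`; the weaker order `1/K` is enough, as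
  -- it matches the Airy error.
  have hqK : ‖q - 1‖ ≤ 4 / K := by
    refine hq1.trans ?_
    have e : ζ / ((K / ν ^ 2 : ℝ) : ℂ) - 1 = -(((ν ^ 3 / K ^ 2 : ℝ) : ℂ) * d) := by
      rw [hd]; push_cast; field_simp; ring
    rw [e, norm_neg, norm_mul, Complex.norm_real, Real.norm_of_nonneg (by positivity)]
    calc ν ^ 3 / K ^ 2 * ‖d‖ ≤ 1 / K * 4 := by
          refine mul_le_mul ?_ hζ (norm_nonneg _) (by positivity)
          refine div_le_div₀ zero_le_one (pow_le_one₀ hν0.le hν.2) hK0 ?_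
          nlinarith
      _ = 4 / K := by ring
  set T : ℝ := K ^ (2 / 3 : ℝ) / ν with hT
  have hK23 : 0 < K ^ (2 / 3 : ℝ) := Real.rpow_pos_of_pos hK0 _
  have hT0 : 0 < T := by positivity
  have hTK : K ^ (2 / 3 : ℝ) ≤ T := by
    rw [hT, le_div_iff₀ hν0]; nlinarith [hν.2]
  set e₅ : ℂ := Complex.exp (-(5 * Real.pi / 12 : ℝ) * Complex.I) with he5
  have he5n : ‖e₅‖ = 1 := by
    rw [he5, ← Complex.ofReal_neg]; exact norm_exp_real_mul_I _
  have he5re : e₅.re = a := by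
    rw [he5, ← Complex.ofReal_neg, Complex.exp_ofReal_mul_I_re, Real.cos_neg]
  set t : ℂ := (T : ℂ) * e₅ * q with ht
  have h4K : 4 / K ≤ a / 2 := by
    rw [div_le_iff₀ hK0]; linarith
  have hqa : ‖q - 1‖ ≤ a / 2 := hqK.trans h4K
  have hqn : ‖q‖ ≤ 2 := by
    have := norm_add_le (q - 1) 1
    rw [sub_add_cancel, norm_one] at this
    linarith
  have hqn' : 1 / 2 ≤ ‖q‖ := by
    have := norm_sub_norm_le (1 : ℂ) q
    rw [norm_one, norm_sub_rev] at this
    linarith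
  have htn : ‖t‖ = T * ‖q‖ := by
    rw [ht, norm_mul, norm_mul, he5n, Complex.norm_real, Real.norm_of_nonneg hT0.le, mul_one]
  have htre : a / 4 * ‖t‖ ≤ t.re := by
    have e : t = (T : ℂ) * (e₅ + e₅ * (q - 1)) := by rw [ht]; ring
    have h1 : t.re = T * (a + (e₅ * (q - 1)).re) := by
      rw [e, Complex.re_ofReal_mul, Complex.add_re, he5re]
    have h2 : -(a / 2) ≤ (e₅ * (q - 1)).re := by
      have h3 := Complex.abs_re_le_norm (e₅ * (q - 1))
      rw [norm_mul, he5n, one_mul] at h3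
      linarith [neg_abs_le (e₅ * (q - 1)).re]
    rw [h1, htn]
    have h3 : a / 4 * ‖q‖ ≤ a + (e₅ * (q - 1)).re := by nlinarith
    calc a / 4 * (T * ‖q‖) = T * (a / 4 * ‖q‖) := by ring
      _ ≤ _ := by gcongr
  have hthalf : K ^ (2 / 3 : ℝ) / 2 ≤ ‖t‖ := by
    rw [htn]
    have : T * (1 / 2) ≤ T * ‖q‖ := by gcongr
    linarith
  have htR : R ≤ ‖t‖ := by
    have h1 : 2 * R ≤ K ^ (2 / 3 : ℝ) := by
      have h2 := Real.rpow_le_rpow (by positivity) hKR (by norm_num : (0 : ℝ) ≤ 2 / 3)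
      rw [← Real.rpow_mul (by positivity)] at h2
      norm_num at h2
      exact h2
    linarith
  have hz : t ^ 2 = scaledAiryPoint K ζ := by
    have h1 : e₅ ^ 2 = -Complex.exp (Real.pi * Complex.I / 6) := by
      rw [he5, ← Complex.exp_nat_mul]
      have : ((2 : ℕ) : ℂ) * (-((5 * Real.pi / 12 : ℝ) : ℂ) * Complex.I)
          = Real.pi * Complex.I / 6 - Real.pi * Complex.I := by push_cast; ring
      rw [this, Complex.exp_sub, Complex.exp_pi_mul_I]
      ring
    have h2 : (T : ℂ) ^ 2 = ((K ^ (1 / 3 : ℝ) : ℝ) : ℂ) * ((K / ν ^ 2 : ℝ) : ℂ) := by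
      rw [← Complex.ofReal_pow, ← Complex.ofReal_mul]
      congr 1
      have : (K ^ (2 / 3 : ℝ)) ^ 2 = K ^ (1 / 3 : ℝ) * K := by
        rw [← Real.rpow_natCast, ← Real.rpow_mul hK0.le, ← Real.rpow_add_one hK0.ne']
        norm_num
      rw [hT, div_pow, this]; ring
    have h3 : ((K / ν ^ 2 : ℝ) : ℂ) ≠ 0 := by
      exact_mod_cast (by positivity : (0 : ℝ) < K / ν ^ 2).ne'
    rw [ht, mul_pow, mul_pow, h1, h2, hq, scaledAiryPoint]
    field_simp
  obtain ⟨hne, ρ, hρ, hρn⟩ := hairy t htR htre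
  rw [hz] at hne hρ
  have hρK : ‖ρ‖ ≤ 4 * C / K := by
    refine hρn.trans ?_
    have h1 : ‖t‖ ^ (-(3 / 2) : ℝ) ≤ (K ^ (2 / 3 : ℝ) / 2) ^ (-(3 / 2) : ℝ) :=
      Real.rpow_le_rpow_of_nonpos (by positivity) hthalf (by norm_num)
    have h2 : (K ^ (2 / 3 : ℝ) / 2) ^ (-(3 / 2) : ℝ) ≤ 4 / K := by
      rw [Real.div_rpow hK23.le (by norm_num), ← Real.rpow_mul hK0.le]
      have e1 : (2 / 3 : ℝ) * -(3 / 2) = -1 := by norm_num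
      rw [e1, Real.rpow_neg_one, Real.rpow_neg (by norm_num), div_inv_eq_mul, inv_mul_eq_div]
      have e2 : (2 : ℝ) ^ (3 / 2 : ℝ) ≤ 2 ^ (2 : ℝ) :=
        Real.rpow_le_rpow_of_exponent_le (by norm_num) (by norm_num)
      gcongr
      refine e2.trans ?_
      norm_num
    calc C * ‖t‖ ^ (-(3 / 2) : ℝ) ≤ C * (4 / K) := by gcongr; exact h1.trans h2
      _ = 4 * C / K := by ring
  have hρ1 : ‖ρ‖ ≤ 1 := hρK.trans (by rw [div_le_one hK0]; exact hKC)
  refine ⟨hne, ?_, ?_⟩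
  · rw [hρ, norm_mul, norm_neg, htn]
    have h1 : ‖1 + ρ‖ ≤ 2 := by
      refine (norm_add_le _ _).trans ?_
      rw [norm_one]; linarith
    calc T * ‖q‖ * ‖1 + ρ‖ ≤ T * 2 * 2 := by gcongr
      _ = _ := by ring
  · have h1 : Complex.exp (Real.pi * Complex.I / 6) * e₅ = Complex.exp (-(Real.pi * Complex.I / 4)) := by
      rw [he5, ← Complex.exp_add]; congr 1; push_cast; ring
    have h2 : ((K ^ (1 / 3 : ℝ) : ℝ) : ℂ) * (T : ℂ) = ((K / ν : ℝ) : ℂ) := by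
      rw [← Complex.ofReal_mul]
      congr 1
      rw [hT, ← mul_div_assoc, ← Real.rpow_add hK0]
      norm_num
    -- Phases and powers of `K` combine into the affine term times `q (1 + ρ)`, and `q (1 + ρ) - 1 =
    -- (q - 1)(1 + ρ) + ρ`.
    have h3 : -(Complex.exp (Real.pi * Complex.I / 6) * ((K ^ (1 / 3 : ℝ) : ℝ) : ℂ)
          * (((K / ν ^ 2 : ℝ) : ℂ) - ζ) * (-t * (1 + ρ)))
        - Complex.exp (-(Real.pi * Complex.I / 4)) * d
        = Complex.exp (-(Real.pi * Complex.I / 4)) * d * ((q - 1) * (1 + ρ) + ρ) := by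
      rw [hd, ← h1, ← h2, ht]; ring
    have h4 : ‖Complex.exp (-(Real.pi * Complex.I / 4))‖ = 1 := by
      have : -(Real.pi * Complex.I / 4 : ℂ) = ((-(Real.pi / 4) : ℝ) : ℂ) * Complex.I := by
        push_cast; ring
      rw [this]; exact norm_exp_real_mul_I _
    rw [hρ, h3, norm_mul, norm_mul, h4, one_mul]
    have h5 : ‖(q - 1) * (1 + ρ) + ρ‖ ≤ 4 / K * 2 + 4 * C / K := by
      refine (norm_add_le _ _).trans (add_le_add ?_ hρK)
      rw [norm_mul]
      gcongr
      refine (norm_add_le _ _).trans ?_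
      rw [norm_one]; linarith
    calc ‖d‖ * ‖(q - 1) * (1 + ρ) + ρ‖ ≤ 4 * (4 / K * 2 + 4 * C / K) := by gcongr
      _ = 4 * (8 + 4 * C) / K := by ring

end

end CompressibleBL

/-! ### Choice of `K` and `ε`, and conclusion -/

theorem proposition2p1 {m θ : ℝ} {U : ℝ → ℝ} (hm : m ∈ Ioo (0 : ℝ) 1) (hθ : θ ∈ Ioo (0 : ℝ) 1)
    (hU : IsBoundaryLayerProfile m U) :
    ∃ K₀ > (1 : ℝ), ∀ K ≥ K₀, ∃ ε₁ ∈ Ioo (0 : ℝ) 1, ∀ ε ∈ Ioo (0 : ℝ) ε₁,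
      (∀ c ∈ disk m θ K ε, 0 < c.im ∧ (∀ Y ≥ 0, coeffA m U c Y ≠ 0) ∧
        airy 2 (airyPoint (waveNumber K ε) ε c) ≠ 0) ∧
      AnalyticOnNhd ℂ (boundaryFn m (waveNumber K ε) ε U) (disk m θ K ε) ∧
      (∃! c : ℂ, c ∈ disk m θ K ε ∧ boundaryFn m (waveNumber K ε) ε U c = 0) ∧
      ∀ c ∈ diskBoundary m θ K ε,
        1 / 2 * K ^ (-θ) ≤ ‖boundaryFn m (waveNumber K ε) ε U c‖ := by
  obtain ⟨C, hC, K₁, hK₁, hdisp⟩ := limit_dispersion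
  have hpos : 0 < 1 - m ^ 2 := by nlinarith [hm.1, hm.2]
  set ν : ℝ := (1 - m ^ 2) ^ (1 / 4 : ℝ) with hν
  have hν0 : 0 < ν := Real.rpow_pos_of_pos hpos _
  have hν1 : ν ≤ 1 := Real.rpow_le_one hpos.le (by nlinarith [hm.1]) (by norm_num)
  have hνc : (ν : ℂ) ≠ 0 := by exact_mod_cast hν0.ne'
  have hν2 : (1 - m ^ 2) ^ (1 / 2 : ℝ) = ν ^ 2 := by
    rw [hν, ← Real.rpow_mul_natCast hpos.le]; norm_num
  -- Smallness of `K^{-θ}` keeps the doubled disk in the upper half plane; the next condition, where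
  -- `θ < 1` enters, makes `C / K` at most `K^{-θ} / 8`.
  have hlim1 : ∀ᶠ K : ℝ in atTop, K ^ (-θ) < 1 / 10 :=
    (tendsto_rpow_neg_atTop hθ.1).eventually (gt_mem_nhds (by norm_num))
  have hlim2 : ∀ᶠ K : ℝ in atTop, K ^ (-(1 - θ)) < 1 / (8 * C) :=
    (tendsto_rpow_neg_atTop (by linarith [hθ.2])).eventually (gt_mem_nhds (by positivity))
  obtain ⟨K₂, hK₂⟩ := eventually_atTop.1 (hlim1.and hlim2)
  refine ⟨max 2 (max K₁ K₂), lt_of_lt_of_le (by norm_num) (le_max_left _ _), fun K hK => ?_⟩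
  have hK2 : 2 ≤ K := (le_max_left _ _).trans hK
  have hKK1 : K₁ ≤ K := ((le_max_left _ _).trans (le_max_right _ _)).trans hK
  obtain ⟨hs1, hs2⟩ := hK₂ K (((le_max_right _ _).trans (le_max_right _ _)).trans hK)
  have hK0 : 0 < K := by linarith
  have hKc : (K : ℂ) ≠ 0 := by exact_mod_cast hK0.ne'
  set x : ℝ := K ^ (-θ) with hx
  have hx0 : 0 < x := Real.rpow_pos_of_pos hK0 _
  have hr : K ^ (-1 - θ) = K⁻¹ * x := by
    rw [sub_eq_add_neg, Real.rpow_add hK0, Real.rpow_neg_one]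
  have hCK : C / K ≤ x / 8 := by
    have e : x * K ^ (-(1 - θ)) = K⁻¹ := by
      rw [hx, ← Real.rpow_add hK0, ← Real.rpow_neg_one]; congr 1; ring
    rw [div_eq_mul_inv, ← e]
    have : C * K ^ (-(1 - θ)) ≤ 1 / 8 := by
      rw [lt_div_iff₀ (by positivity)] at hs2
      linarith
    nlinarith
  set e₄ : ℂ := Complex.exp (Real.pi * Complex.I / 4) with he4
  have he4' : e₄ = Complex.exp (((Real.pi / 4 : ℝ) : ℂ) * Complex.I) := by
    rw [he4]; congr 1; push_cast; ring
  have he4n : ‖e₄‖ = 1 := by rw [he4']; exact norm_exp_real_mul_I _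
  have he4im : 1 / 2 ≤ e₄.im := by
    rw [he4', Complex.exp_ofReal_mul_I_im, Real.sin_pi_div_four]
    have : (1 : ℝ) ≤ √2 := Real.one_le_sqrt.2 (by norm_num)
    linarith
  have he40 : e₄ ≠ 0 := Complex.exp_ne_zero _
  set ζ₀ : ℂ := ((K / ν ^ 2 : ℝ) : ℂ) + ((K⁻¹ * ν : ℝ) : ℂ) * e₄ with hζ₀
  set r : ℝ := K⁻¹ * ν * x with hrdef
  have hKν : 0 < K⁻¹ * ν := by positivity
  have hr0 : 0 < r := by positivity
  set D : Set ℂ := Metric.closedBall ζ₀ (2 * r) with hDdef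
  have hcond : ∀ ζ ∈ D, ‖((K / ν : ℝ) : ℂ) * (((K / ν ^ 2 : ℝ) : ℂ) - ζ)‖ ≤ 4 := by
    intro ζ hζ
    rw [hDdef, Metric.mem_closedBall, dist_eq_norm] at hζ
    have e : ((K / ν ^ 2 : ℝ) : ℂ) - ζ = -(ζ - ζ₀) - ((K⁻¹ * ν : ℝ) : ℂ) * e₄ := by
      rw [hζ₀]; ring
    have h1 : ‖((K / ν ^ 2 : ℝ) : ℂ) - ζ‖ ≤ 2 * r + K⁻¹ * ν := by
      rw [e]
      refine (norm_sub_le _ _).trans ?_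
      rw [norm_neg, norm_mul, he4n, mul_one, Complex.norm_real, Real.norm_of_nonneg hKν.le]
      linarith
    rw [norm_mul, Complex.norm_real, Real.norm_of_nonneg (by positivity)]
    calc K / ν * ‖((K / ν ^ 2 : ℝ) : ℂ) - ζ‖ ≤ K / ν * (2 * r + K⁻¹ * ν) := by gcongr
      _ = 2 * x + 1 := by rw [hrdef]; field_simp
      _ ≤ 4 := by linarith
  -- The centre has imaginary part at least `K⁻¹ν/2`, as `sin(π/4) ≥ 1/2`, and the doubled radius
  -- takes away at most `K⁻¹ν/4`.
  have hD : ∀ ζ ∈ D, ‖ζ‖ ≤ ‖ζ₀‖ + 2 * r ∧ K⁻¹ * ν / 4 ≤ ζ.im := by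
    intro ζ hζ
    rw [hDdef, Metric.mem_closedBall, dist_eq_norm] at hζ
    refine ⟨?_, ?_⟩
    · have := norm_add_le (ζ - ζ₀) ζ₀
      rw [sub_add_cancel] at this
      linarith
    · have h1 := (Complex.abs_im_le_norm (ζ - ζ₀)).trans hζ
      have h2 := neg_abs_le (ζ - ζ₀).im
      have h3 : ζ₀.im = K⁻¹ * ν * e₄.im := by
        rw [hζ₀, Complex.add_im, Complex.ofReal_im, Complex.im_ofReal_mul, zero_add]
      rw [Complex.sub_im, h3] at h1 h2
      have h4 : 2 * r ≤ K⁻¹ * ν * (1 / 4) := by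
        rw [hrdef]; nlinarith
      nlinarith
  have hev := boundaryFn_limit hm hU hK0 (by positivity : 0 ≤ ‖ζ₀‖ + 2 * r)
    (by positivity : 0 < K⁻¹ * ν / 4) hD (Q := 4 * (K ^ (2 / 3 : ℝ) / ν))
    (fun ζ hζ => ⟨(hdisp ν ⟨hν0, hν1⟩ K hKK1 ζ (hcond ζ hζ)).1,
      (hdisp ν ⟨hν0, hν1⟩ K hKK1 ζ (hcond ζ hζ)).2.1⟩) (by positivity : 0 < x / 8)
  obtain ⟨ε₂, hε₂, hball⟩ := mem_nhdsGT_iff_exists_Ioo_subset.1 hev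
  have hε₂0 : 0 < ε₂ := hε₂
  refine ⟨min ε₂ (1 / 2), ⟨by positivity, (min_le_right _ _).trans_lt (by norm_num)⟩,
    fun ε hε => ?_⟩
  have hε0 : 0 < ε := hε.1
  have hmain := hball ⟨hε.1, hε.2.trans_le (min_le_left _ _)⟩
  rw [mem_ofPred_eq] at hmain
  set η : ℝ := ε ^ (1 / 8 : ℝ) with hη
  have hη0 : 0 < η := Real.rpow_pos_of_pos hε0 _
  have hηc : (η : ℂ) ≠ 0 := by exact_mod_cast hη0.ne'
  have hcenter : diskCenter m K ε = ζ₀ * η := by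
    unfold diskCenter
    rw [hν2]
  have hradius : diskRadius m θ K ε = r * η := by
    unfold diskRadius
    rw [hr, ← hν, ← hη, hrdef]; ring
  have hscaled : ∀ c ∈ Metric.closedBall (diskCenter m K ε) (2 * diskRadius m θ K ε),
      c / η ∈ D := by
    intro c hc
    rw [hcenter, hradius, Metric.mem_closedBall, dist_eq_norm] at hc
    rw [hDdef, Metric.mem_closedBall, dist_eq_norm]
    have e : c / η - ζ₀ = (c - ζ₀ * η) / η := by field_simp
    rw [e, norm_div, Complex.norm_real, Real.norm_of_nonneg hη0.le, div_le_iff₀ hη0]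
    linarith
  have hunscale : ∀ c : ℂ, (η : ℂ) * (c / η) = c := fun c => by field_simp
  have hreg : ∀ c ∈ Metric.closedBall (diskCenter m K ε) (2 * diskRadius m θ K ε),
      c ∈ regularSet m (waveNumber K ε) ε := by
    intro c hc
    have := (hmain _ (hscaled c hc)).1
    rwa [hunscale] at this
  have hrad0 : 0 < diskRadius m θ K ε := by rw [hradius]; positivity
  have hsub : disk m θ K ε ⊆ Metric.closedBall (diskCenter m K ε) (2 * diskRadius m θ K ε) :=
    Metric.closedBall_subset_closedBall (by linarith)
  have hα : waveNumber K ε ≠ 0 := (mul_pos hK0 hη0).ne'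
  have hδ : sublayerScale (waveNumber K ε) ε ≠ 0 := by
    rw [sublayerScale_waveNumber hK0 hε0]
    have : ((K ^ (1 / 3 : ℝ) : ℝ) : ℂ) ≠ 0 := by
      exact_mod_cast (Real.rpow_pos_of_pos hK0 _).ne'
    exact mul_ne_zero (mul_ne_zero (inv_ne_zero (Complex.exp_ne_zero _)) (inv_ne_zero this)) hηc
  have hdiff := boundaryFn_differentiableOn (ε := ε) hU hm.1 hα hδ
  have hanal := hdiff.analyticOnNhd (isOpen_regularSet _ _ _)
  -- Slope of the affine model in the unscaled variable, normalized so that `‖κ‖` times the disk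
  -- radius is `K^{-θ}`.
  set κ : ℂ := e₄⁻¹ * ((K / ν : ℝ) : ℂ) / η with hκ
  have hKν' : ((K / ν : ℝ) : ℂ) ≠ 0 := by
    exact_mod_cast (by positivity : (0 : ℝ) < K / ν).ne'
  have hκ0 : κ ≠ 0 := div_ne_zero (mul_ne_zero (inv_ne_zero he40) hKν') hηc
  have hκr : ‖κ‖ * diskRadius m θ K ε = x := by
    rw [hκ, hradius, norm_div, norm_mul, norm_inv, he4n, Complex.norm_real, Complex.norm_real,
      Real.norm_of_nonneg hη0.le, Real.norm_of_nonneg (by positivity), hrdef]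
    field_simp
  have hzero := existsUnique_zero_of_norm_sub_affine_le hrad0 hκ0 (hdiff.mono hreg) (fun c hc => by
    obtain ⟨-, h1⟩ := hmain _ (hscaled c hc)
    have h2 := (hdisp ν ⟨hν0, hν1⟩ K hKK1 _ (hcond _ (hscaled c hc))).2.2
    rw [hunscale] at h1
    set ζ : ℂ := c / η with hζ
    have hexp : Complex.exp (-(Real.pi * Complex.I / 4)) = e₄⁻¹ := by
      rw [he4, ← Complex.exp_neg]
    rw [hexp] at h2
    have hlin : κ * (diskCenter m K ε - c)
        = 1 + e₄⁻¹ * (((K / ν : ℝ) : ℂ) * (((K / ν ^ 2 : ℝ) : ℂ) - ζ)) := by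
      rw [hcenter, hκ, hζ, hζ₀]
      push_cast
      field_simp
      ring
    have hsum : boundaryFn m (waveNumber K ε) ε U c - κ * (diskCenter m K ε - c)
        = (boundaryFn m (waveNumber K ε) ε U c - limitFn m K ζ)
          + (limitFn m K ζ - κ * (diskCenter m K ε - c)) := by ring
    have hdist : ‖limitFn m K ζ - κ * (diskCenter m K ε - c)‖ ≤ C / K := by
      refine le_trans (le_of_eq ?_) h2
      congr 1
      rw [hlin, limitFn, hν2]
      ring
    -- The viscous error `x/8` and the large-`K` error `C/K ≤ x/8` add up to the admissible quarter
    -- of `‖κ‖` times the radius.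
    rw [hsum, hκr]
    refine (norm_add_le _ _).trans ?_
    linarith)
  rw [hκr] at hzero
  refine ⟨fun c hc => ?_, hanal.mono fun c hc => hreg c (hsub hc), hzero.1, hzero.2⟩
  obtain ⟨h1, h2, h3⟩ := hreg c (hsub hc)
  exact ⟨h1, fun Y hY => coeffA_ne_zero hU hm.1.le h2 hY, h3⟩
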